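/- Let $Q$ be a complex polynomial. Its zeros are called turning points. A Stokes curve emanating from a turning point $a$ is a curve starting at $a$ along which $\operatorname{Im}\int_a^x\sqrt{Q(\tau)}\,d\tau=0$ and which contains no turning point other than $a$; the connected components of the complement of the closed set formed by the turning points and all Stokes curves are called Stokes domains. Let $\Omega$ be a Stokes domain, $a\in\partial\Omega$ a turning point, $\sqrt Q$ a holomorphic branch in $\Omega$ and $\mathfrak S_a(x)=\int_a^x\sqrt{Q(\tau)}\,d\tau$ (the primitive of $\sqrt Q$ in $\Omega$ that tends to $0$ at $a$), and assume $\operatorname{Im}\mathfrak S_a>0$ in $\Omega$. Put $\mu=\sup_\Omega\operatorname{Im}\mathfrak S_a\in(0,+\infty]$ and, for $\delta>0$, $\Omega_\delta=\{x\in\Omega:\ \delta<\operatorname{Im}\mathfrak S_a(x)<\mu-\delta\}$. For $x\in\Omega$ let $\varphi(\cdot,x)$ be the solution in $\Omega$ of $y'(t)=1/\sqrt{Q(y(t))}$, $y(0)=x$. Let $s_1=-\frac{Q'}{4Q}$, $C=-(s_1'+s_1^2)$ and, for $h>0$, $$(K_+f)(x,h)=\sqrt{Q(x)}\int_{-\infty}^0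 e^{2t/h}\,\frac{f(\varphi(t,x))}{Q(\varphi(t,x))}\,dt .$$ Define $W_1=K_+C$, $W_n=-\sum_{i+j=n,\ i,j\ge1}K_+(W_iW_j)$ for $n\ge2$, $g_n=W_n/\sqrt Q$, $W=\sum_{n\ge1}W_n$ and $g=\sum_{n\ge1}g_n$. For functions $\psi(x,h)$ and $a_k(x)$, the relation $\psi\sim\sum_{k\ge0}a_k(x)h^k$ means: every $a_k$ is holomorphic in $\Omega$, and for every $\delta>0$ there is $H>0$ such that $\psi(\cdot,h)$ is holomorphic in $\Omega_\delta$ for $0<h<H$ and, for every $N\ge0$, there is a constant $C_N(\delta)$ with $$\Big|\psi(x,h)-\sum_{k=0}^N a_k(x)h^k\Big|\le C_N(\delta)\,h^{N+1}\qquad(x\in\Omega_\delta,\ 0<h<H).$$ Theorem. For every $x\in\Omega$ the solution $\varphi(t,x)$ exists in $\Omega$ for all $t\in\mathbb R$, and all the integrals defining the $W_n$ converge absolutely for $x\in\Omega$, $h>0$. For every $\delta>0$ there is $H>0$ such that for $0<h<H$ and $x\in\Omega_\delta$ the series $\sum_n g_n(x,h)$ converges absolutely, $W=\sqrt Q\,g$,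 the integral defining $K_+(W^2)$ converges absolutely, and $W$ solves the integral equation $$W=-K_+(W^2)+K_+C .$$ Moreover there are holomorphic functions $a_{n,k}$ in $\Omega$ ($n\ge1$, $k\ge 2n-1$), with $a_{1,1}=\frac{C}{2Q}$, such that $g_n\sim\sum_{k\ge 2n-1}a_{n,k}(x)h^k$ for every $n\ge1$, and $g$ has the asymptotic expansion $$g(x,h)\sim\sum_{k=1}^\infty a_k(x)h^k,\qquad a_k=\sum_{n=1}^{\lfloor (k+1)/2\rfloor}a_{n,k}.$$ -/

import Mathlib

open Set Filter Topology MeasureTheory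

noncomputable section

namespace WKB

/-- `IsStokesArc Q a T γ`: the arc `γ : [0, T) → ℂ` starts at `a` and, for `0 < t < T`,
satisfies `Q(γ) (γ')² = 1`. Thus `1 / γ'` is a branch of `√Q` along the arc, for which
`∫_a^{γ(t)} √Q dτ = t` is real. Every arc from `a` on which `Im ∫_a^x √Q dτ = 0`, and which
contains no further turning point, has such a parametrization (by `±Re ∫_a^x √Q dτ`). -/
structure IsStokesArc (Q : Polynomial ℂ) (a : ℂ) (T : ℝ) (γ : ℝ → ℂ) : Prop where
  start : γ 0 = a
  cont : ContinuousOn γ (Ico 0 T)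
  deriv_sq : ∀ t ∈ Ioo 0 T, ∃ v : ℂ, HasDerivAt γ v t ∧ Q.eval (γ t) * v ^ 2 = 1

/-- The union of all Stokes curves: the turning points `a` (zeros of `Q`), together with all
points of all Stokes curves emanating from them. -/
def stokesGraph (Q : Polynomial ℂ) : Set ℂ :=
  {p | Q.IsRoot p} ∪
    {p | ∃ a T γ, Q.IsRoot a ∧ IsStokesArc Q a T γ ∧ ∃ t ∈ Ico 0 T, γ t = p}

/-- A Stokes domain: one of the regions into which the Stokes curves divide the plane, that is,
a connected component of the complement of the (closed) set formed by the Stokes curves. -/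
def IsStokesDomain (Q : Polynomial ℂ) (Ω : Set ℂ) : Prop :=
  ∃ p ∈ (closure (stokesGraph Q))ᶜ, Ω = connectedComponentIn (closure (stokesGraph Q))ᶜ p

/-- `r` is a holomorphic branch of `√Q` in `Ω`. -/
structure IsSqrtBranch (Q : Polynomial ℂ) (Ω : Set ℂ) (r : ℂ → ℂ) : Prop where
  holo : DifferentiableOn ℂ r Ω
  sq : ∀ x ∈ Ω, r x ^ 2 = Q.eval x

/-- `S(x) = ∫_a^x r(τ) dτ` for `x ∈ Ω`, where `a ∈ ∂Ω`: the primitive of `r` in `Ω` that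
vanishes at `a`. -/
structure IsIntegralFrom (Ω : Set ℂ) (a : ℂ) (r S : ℂ → ℂ) : Prop where
  hasDerivAt : ∀ x ∈ Ω, HasDerivAt S (r x) x
  vanish : Tendsto S (𝓝[Ω] a) (𝓝 0)

/-- `μ = sup_{x ∈ Ω} Im S(x)`, possibly `+∞`. -/
def mu (Ω : Set ℂ) (S : ℂ → ℂ) : EReal := ⨆ x ∈ Ω, (((S x).im : ℝ) : EReal)

/-- `Ω_δ = {x ∈ Ω ; δ < Im S(x) < μ - δ}`. -/
def subdomain (Ω : Set ℂ) (S : ℂ → ℂ) (δ : ℝ) : Set ℂ :=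
  {x | x ∈ Ω ∧ δ < (S x).im ∧ (((S x).im : ℝ) : EReal) < mu Ω S - (δ : EReal)}

/-- `y` solves `y' = 1 / √Q(y)`, `y(0) = x`, in `Ω`, on the whole real line. -/
def IsTrajectory (Ω : Set ℂ) (r : ℂ → ℂ) (x : ℂ) (y : ℝ → ℂ) : Prop :=
  y 0 = x ∧ ∀ t, y t ∈ Ω ∧ HasDerivAt y (1 / r (y t)) t

open Classical in
/-- `φ(t, x)`: the solution of `y' = 1 / √Q(y)`, `y(0) = x`, at time `t`
(with the value `x` where there is no solution). -/
def flow (Ω : Set ℂ) (r : ℂ → ℂ) (t : ℝ) (x : ℂ) : ℂ :=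
  if hx : ∃ y, IsTrajectory Ω r x y then hx.choose t else x

/-- `s₁ = -Q' / (4 Q)`. -/
def s1 (Q : Polynomial ℂ) (x : ℂ) : ℂ := -(Q.derivative.eval x) / (4 * Q.eval x)

/-- `C = -(s₁' + s₁²)`. -/
def potC (Q : Polynomial ℂ) (x : ℂ) : ℂ := -(deriv (s1 Q) x + s1 Q x ^ 2)

/-- The integrand `exp(2t/h) f(φ(t,x)) / Q(φ(t,x))` of the integral operator `K₊`. -/
def integrand (Q : Polynomial ℂ) (Ω : Set ℂ) (r : ℂ → ℂ) (h : ℝ) (f : ℂ → ℂ) (x : ℂ)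
    (t : ℝ) : ℂ :=
  (Real.exp (2 * t / h) : ℂ) * (f (flow Ω r t x) / Q.eval (flow Ω r t x))

/-- `(K₊ f)(x, h) = √Q(x) ∫_{-∞}^0 exp(2t/h) f(φ(t,x)) / Q(φ(t,x)) dt`. -/
def Kplus (Q : Polynomial ℂ) (Ω : Set ℂ) (r : ℂ → ℂ) (h : ℝ) (f : ℂ → ℂ) (x : ℂ) : ℂ :=
  r x * ∫ t in Iic (0 : ℝ), integrand Q Ω r h f x t

/-- The successive terms `W₁ = K₊ C`, `W_n = -∑_{i + j = n} K₊ (W_i W_j)` (`i, j ≥ 1`) for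
`n ≥ 2`; the index `0` is filled with `W₀ = 0`. -/
def Wterm (Q : Polynomial ℂ) (Ω : Set ℂ) (r : ℂ → ℂ) (h : ℝ) : ℕ → ℂ → ℂ
  | 0 => fun _ => 0
  | 1 => Kplus Q Ω r h (potC Q)
  | n + 2 => fun x => -∑ i : Fin (n + 1),
      Kplus Q Ω r h (fun y => Wterm Q Ω r h (i + 1) y * Wterm Q Ω r h (n + 1 - i) y) x
  termination_by n => n
  decreasing_by all_goals omega

/-- `W = ∑_n W_n`. -/
def Wsum (Q : Polynomial ℂ) (Ω : Set ℂ) (r : ℂ → ℂ) (x : ℂ) (h : ℝ) : ℂ :=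
  ∑' n, Wterm Q Ω r h n x

/-- `g_n = W_n / √Q`. -/
def gTerm (Q : Polynomial ℂ) (Ω : Set ℂ) (r : ℂ → ℂ) (n : ℕ) (x : ℂ) (h : ℝ) : ℂ :=
  Wterm Q Ω r h n x / r x

/-- `g = ∑_n g_n`. -/
def gSum (Q : Polynomial ℂ) (Ω : Set ℂ) (r : ℂ → ℂ) (x : ℂ) (h : ℝ) : ℂ :=
  ∑' n, gTerm Q Ω r n x h

/-- `ψ(x, h) ∼ ∑_{n ≥ 0} a_n(x) hⁿ`: the `a_n` are holomorphic in `Ω` and, for every `δ > 0`,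
there is `H > 0` such that, for `0 < h < H`, `ψ(·, h)` is holomorphic in `Ω_δ` and all
remainders are `O(h^(N+1))` uniformly in `x ∈ Ω_δ`. -/
def HasExpansion (Ω : Set ℂ) (S : ℂ → ℂ) (ψ : ℂ → ℝ → ℂ) (a : ℕ → ℂ → ℂ) : Prop :=
  (∀ n, DifferentiableOn ℂ (a n) Ω) ∧
  ∀ δ : ℝ, 0 < δ → ∃ H : ℝ, 0 < H ∧
    (∀ h ∈ Ioo 0 H, DifferentiableOn ℂ (fun x => ψ x h) (subdomain Ω S δ)) ∧
    ∀ N : ℕ, ∃ C : ℝ, ∀ h ∈ Ioo 0 H, ∀ x ∈ subdomain Ω S δ,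
      ‖ψ x h - ∑ n ∈ Finset.range (N + 1), a n x * (h : ℂ) ^ n‖ ≤ C * h ^ (N + 1)

end WKB

end

/-! The primitive `S = ∫ √Q` straightens the whole problem: it maps `Ω` biholomorphically onto the
strip (or half-plane) `0 < Im w < μ`. There the flow is `w ↦ w + t`, and `K₊ f` becomes `√Q` times
the operator `lap h` applied to `f / Q`. Since `W_i W_j / Q = g_i g_j`, the functions `g_n` satisfy
a weight-free recursion with the single datum `F = C / Q` (`stripPot`).

Biholomorphy. Horizontal segments lift through `S`. A lift over a bounded time has a limit point
(`IsLift.exists_tendsto`). That point is no turning point, since otherwise the reversed lift would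
be a Stokes curve inside `Ω`; nor is it on the closed Stokes graph, which is invariant under
horizontal translation in a local chart. So lifts extend to all of `ℝ` (`exists_lift_line`). Flowing
to the section `Re S = 0` then reduces injectivity of `S` to that of an open, locally injective real
function on a connected space. Surjectivity follows from `S → 0` at `a`, connectedness and the
lifted lines.

Estimates. Points of `Ω_δ` keep a positive distance from the turning points, and `C / Q` is a
rational function bounded at infinity, so `F` is bounded on every smaller strip. As `lap h` has norm
at most `h / 2`, the recursion is dominated by the Catalan recursion. The series for `g` is
therefore dominated by a geometric series for small `h`, and the Cauchy product yields the integral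
equation.

Expansions. Integration by parts, `lap f = (h/2) f - (h/2) lap f'`, expands `lap h f` in powers of
`h`, and Cauchy estimates keep derivatives in the same class of functions. The expansion of `g_n`
starts at `h^(2n-1)`, so each power of `h` in `g` collects only finitely many `a_{n,k}`. -/

noncomputable section

namespace WKB

/-! ### Open, locally injective functions into the real line -/

/-- Two sets on which `f` is injective can be glued if they meet and their images have a
preconnected intersection. -/
theorem injOn_union_of_isPreconnected {X Y : Type*} [TopologicalSpace X] [T2Space X]
    [TopologicalSpace Y] {f : X → Y} (hfo : IsOpenMap f) {V B : Set X}
    (hV : IsOpen V) (hB : IsOpen B) (hVi : InjOn f V) (hBi : InjOn f B)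
    (hne : (V ∩ B).Nonempty) (hpre : IsPreconnected (f '' V ∩ f '' B)) : InjOn f (V ∪ B) := by
  have key : f '' V ∩ f '' B ⊆ f '' (V ∩ B) := by
    -- The image of `V ∩ B` is open and relatively closed in the connected intersection of the
    -- images. If a limit value were attained at distinct points `v`, `b`, some `u ∈ V ∩ B` with a
    -- nearby value would, by injectivity on `V` and on `B`, lie in disjoint neighbourhoods of both.
    apply hpre.subset_of_closure_inter_subset (hfo _ (hV.inter hB))
    · obtain ⟨x, hxV, hxB⟩ := hne
      exact ⟨f x, ⟨⟨x, hxV, rfl⟩, ⟨x, hxB, rfl⟩⟩, ⟨x, ⟨hxV, hxB⟩, rfl⟩⟩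
    · rintro w ⟨hw, ⟨v, hv, rfl⟩, ⟨b, hb, hbv⟩⟩
      have hvb : v = b := by
        by_contra hne'
        obtain ⟨O, P, hO, hP, hvO, hbP, hOP⟩ := t2_separation hne'
        have h1 : f '' (V ∩ O) ∩ f '' (B ∩ P) ∈ 𝓝 (f v) :=
          inter_mem ((hfo _ (hV.inter hO)).mem_nhds ⟨v, ⟨hv, hvO⟩, rfl⟩)
            ((hfo _ (hB.inter hP)).mem_nhds ⟨b, ⟨hb, hbP⟩, hbv⟩)
        obtain ⟨_, ⟨⟨v', hv', hv'e⟩, ⟨b', hb', hb'e⟩⟩, ⟨u, hu, rfl⟩⟩ :=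
          mem_closure_iff_nhds.1 hw _ h1
        have e1 : v' = u := hVi hv'.1 hu.1 hv'e
        have e2 : b' = u := hBi hb'.1 hu.2 hb'e
        exact (hOP.ne_of_mem hv'.2 hb'.2) (e1.trans e2.symm)
      exact ⟨v, ⟨hv, hvb ▸ hb⟩, rfl⟩
  have cross : ∀ v ∈ V, ∀ b ∈ B, f v = f b → v = b := by
    intro v hv b hb h
    obtain ⟨u, hu, hue⟩ := key ⟨⟨v, hv, rfl⟩, ⟨b, hb, h.symm⟩⟩
    rw [← hVi hu.1 hv hue]
    exact hBi hu.2 hb (hue.trans h)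
  rintro x (hx | hx) y (hy | hy) h
  · exact hVi hx hy h
  · exact cross x hx y hy h
  · exact (cross y hy x hx h.symm).symm
  · exact hBi hx hy h

/-- A continuous, open and locally injective real function on a connected Hausdorff space is
injective. -/
theorem injective_of_isOpenMap_real {X : Type*} [TopologicalSpace X] [T2Space X]
    [PreconnectedSpace X] {f : X → ℝ} (hf : Continuous f) (hfo : IsOpenMap f)
    (hloc : ∀ x, ∃ U ∈ 𝓝 x, InjOn f U) : Function.Injective f := by
  have small : ∀ x, ∃ B : Set X, IsOpen B ∧ x ∈ B ∧ InjOn f B ∧ IsPreconnected B := by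
    intro x
    obtain ⟨U, hU, hUi⟩ := hloc x
    obtain ⟨O, hOU, hO, hxO⟩ := mem_nhds_iff.1 hU
    obtain ⟨ε, hε, hball⟩ := Metric.isOpen_iff.1 (hfo O hO) (f x) ⟨x, hxO, rfl⟩
    refine ⟨O ∩ f ⁻¹' Metric.ball (f x) ε, hO.inter (Metric.isOpen_ball.preimage hf),
      ⟨hxO, Metric.mem_ball_self hε⟩, hUi.mono (inter_subset_left.trans hOU), ?_⟩
    have himg : f '' (O ∩ f ⁻¹' Metric.ball (f x) ε) = Metric.ball (f x) ε := by
      rw [image_inter_preimage, inter_eq_right]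
      exact hball
    have hpre : IsPreconnected (f '' (O ∩ f ⁻¹' Metric.ball (f x) ε)) := by
      rw [himg]; exact (convex_ball _ _).isPreconnected
    set B := O ∩ f ⁻¹' Metric.ball (f x) ε
    have hBo : IsOpen B := hO.inter (Metric.isOpen_ball.preimage hf)
    have hBi : InjOn f B := hUi.mono (inter_subset_left.trans hOU)
    -- A splitting of `B` is pushed forward to the connected image. A value common to both parts
    -- comes from one point, as `f` is injective on `B`.
    intro u v hu hv huv ⟨p, hpB, hpu⟩ ⟨q, hqB, hqv⟩
    obtain ⟨w, hw, ⟨y, ⟨hyB, hyu⟩, rfl⟩, ⟨y', ⟨hyB', hyv⟩, hyy⟩⟩ := hpre (f '' (B ∩ u)) (f '' (B ∩ v))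
      (hfo _ (hBo.inter hu)) (hfo _ (hBo.inter hv))
      (by
        rintro _ ⟨y, hy, rfl⟩
        rcases huv hy with h | h
        · exact Or.inl ⟨y, ⟨hy, h⟩, rfl⟩
        · exact Or.inr ⟨y, ⟨hy, h⟩, rfl⟩)
      ⟨f p, ⟨p, hpB, rfl⟩, ⟨p, ⟨hpB, hpu⟩, rfl⟩⟩ ⟨f q, ⟨q, hqB, rfl⟩, ⟨q, ⟨hqB, hqv⟩, rfl⟩⟩
    have : y' = y := hBi hyB' hyB hyy
    exact ⟨y, hyB, hyu, this ▸ hyv⟩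
  intro x₁ x₂ h12
  obtain ⟨B₀, hB₀o, hxB₀, hB₀i, hB₀c⟩ := small x₁
  -- A maximal member of `𝒮` is closed: a small set around a boundary point can be glued to it,
  -- because both images are intervals and so is their intersection. Only here does it matter that
  -- the target is `ℝ`.
  let 𝒮 : Set (Set X) := {V | IsOpen V ∧ x₁ ∈ V ∧ InjOn f V ∧ IsPreconnected V}
  obtain ⟨V, -, hVmax⟩ := zorn_subset_nonempty 𝒮 (by
    intro c hc hchain hcne
    refine ⟨⋃₀ c, ⟨isOpen_sUnion fun s hs => (hc hs).1, ?_, ?_, ?_⟩,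
      fun s hs => subset_sUnion_of_mem hs⟩
    · obtain ⟨s, hs⟩ := hcne
      exact ⟨s, hs, (hc hs).2.1⟩
    · rintro x ⟨s, hs, hxs⟩ y ⟨t, ht, hyt⟩ hxy
      rcases hchain.total hs ht with h | h
      · exact (hc ht).2.2.1 (h hxs) hyt hxy
      · exact (hc hs).2.2.1 hxs (h hyt) hxy
    · exact isPreconnected_sUnion x₁ c (fun s hs => (hc hs).2.1) fun s hs => (hc hs).2.2.2)
    B₀ ⟨hB₀o, hxB₀, hB₀i, hB₀c⟩
  obtain ⟨hVo, hxV, hVi, hVc⟩ := hVmax.prop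
  have hclosed : closure V ⊆ V := by
    intro z hz
    obtain ⟨B, hBo, hzB, hBi, hBc⟩ := small z
    have hne : (V ∩ B).Nonempty := by
      obtain ⟨y, hy⟩ := mem_closure_iff.1 hz B hBo hzB
      exact ⟨y, hy.2, hy.1⟩
    have hunion : V ∪ B ∈ 𝒮 := by
      refine ⟨hVo.union hBo, Or.inl hxV, injOn_union_of_isPreconnected hfo hVo hBo hVi hBi hne ?_,
        hVc.union' hne hBc⟩
      have h1 := (hVc.image f hf.continuousOn).ordConnected
      have h2 := (hBc.image f hf.continuousOn).ordConnected
      exact (h1.inter h2).isPreconnected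
    exact hVmax.le_of_ge hunion subset_union_left (Or.inr hzB)
  have huniv : V = univ :=
    IsClopen.eq_univ ⟨isClosed_of_closure_subset hclosed, hVo⟩ ⟨x₁, hxV⟩
  exact hVi (huniv ▸ mem_univ _) (huniv ▸ mem_univ _) h12

/-! ### Local coordinates `∫ √Q` and Stokes curves in them -/

/-- `z` is a holomorphic inverse of `s` between the ball of radius `ε` about `s p` and the
neighbourhood `N ⊆ U` of `p`, where `s' = ρ`. -/
structure IsLocalInverse (s ρ : ℂ → ℂ) (U : Set ℂ) (p : ℂ) (ε : ℝ) (z : ℂ → ℂ) (N : Set ℂ) :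
    Prop where
  pos : 0 < ε
  isOpen : IsOpen N
  mem : p ∈ N
  subset : N ⊆ U
  mapsTo : ∀ w ∈ Metric.ball (s p) ε, z w ∈ N
  mapsTo' : ∀ x ∈ N, s x ∈ Metric.ball (s p) ε
  right_inv : ∀ w ∈ Metric.ball (s p) ε, s (z w) = w
  left_inv : ∀ x ∈ N, z (s x) = x
  hasDerivAt : ∀ w ∈ Metric.ball (s p) ε, HasDerivAt z (1 / ρ (z w)) w

theorem exists_isLocalInverse {s ρ : ℂ → ℂ} {U : Set ℂ} (hU : IsOpen U)
    (hs : ∀ x ∈ U, HasDerivAt s (ρ x) x) (hρ : ∀ x ∈ U, ρ x ≠ 0) {p : ℂ} (hp : p ∈ U) :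
    ∃ ε z N, IsLocalInverse s ρ U p ε z N := by
  have hd : DifferentiableOn ℂ s U := fun x hx => (hs x hx).differentiableAt.differentiableWithinAt
  have hst : HasStrictDerivAt s (ρ p) p := by
    have h1 : ContDiffAt ℂ 1 s p := (hd.analyticAt (hU.mem_nhds hp)).contDiffAt
    exact h1.hasStrictDerivAt' (hs p hp) (by norm_num)
  let e₀ := (hst.hasStrictFDerivAt_equiv (hρ p hp)).toOpenPartialHomeomorph s
  have he₀ : ∀ x, e₀ x = s x := fun x => rfl
  have hp₀ : p ∈ e₀.source :=
    (hst.hasStrictFDerivAt_equiv (hρ p hp)).mem_toOpenPartialHomeomorph_source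
  let e := e₀.restrOpen U hU
  have hpe : p ∈ e.source := ⟨hp₀, hp⟩
  have he : ∀ x, e x = s x := fun x => rfl
  have heU : e.source ⊆ U := fun x hx => hx.2
  obtain ⟨ε, hε, hball⟩ := Metric.isOpen_iff.1 e.open_target (s p) (e.map_source hpe)
  refine ⟨ε, e.symm, e.source ∩ s ⁻¹' Metric.ball (s p) ε, hε, ?_, ?_, ?_, ?_, ?_, ?_, ?_, ?_⟩
  · exact (hd.continuousOn.mono heU).isOpen_inter_preimage e.open_source Metric.isOpen_ball
  · exact ⟨hpe, Metric.mem_ball_self hε⟩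
  · exact inter_subset_left.trans heU
  · intro w hw
    refine ⟨e.map_target (hball hw), ?_⟩
    have := e.right_inv (hball hw)
    rw [he] at this
    rwa [mem_preimage, this]
  · intro x hx
    exact hx.2
  · intro w hw
    exact e.right_inv (hball hw)
  · intro x hx
    exact e.left_inv hx.1
  · intro w hw
    have hm := heU (e.map_target (hball hw))
    rw [one_div]
    exact e.hasDerivAt_symm (hball hw) (hρ _ hm) (hs _ hm)

/-- Near a point where `Q` does not vanish, there is a holomorphic branch of `√Q` that has a
primitive. -/
theorem exists_local_sqrt (Q : Polynomial ℂ) {p : ℂ} (hp : Q.eval p ≠ 0) :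
    ∃ (U : Set ℂ) (ρ s : ℂ → ℂ), IsOpen U ∧ p ∈ U ∧ (∀ x ∈ U, Q.eval x ≠ 0) ∧
      (∀ x ∈ U, ρ x ^ 2 = Q.eval x) ∧ ∀ x ∈ U, HasDerivAt s (ρ x) x := by
  have hcont : ContinuousAt (fun x => Q.eval x / Q.eval p) p :=
    (Q.continuous.div_const _).continuousAt
  have hnear : ∀ᶠ x in 𝓝 p, Q.eval x / Q.eval p ∈ Complex.slitPlane :=
    hcont.eventually_mem (Complex.isOpen_slitPlane.mem_nhds (by simp [hp]))
  obtain ⟨η, hη, hball⟩ := Metric.eventually_nhds_iff_ball.1 hnear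
  obtain ⟨c, hc⟩ := IsAlgClosed.exists_pow_nat_eq (Q.eval p) two_pos
  let ρ : ℂ → ℂ := fun x => c * Complex.exp (Complex.log (Q.eval x / Q.eval p) / 2)
  have hne : ∀ x ∈ Metric.ball p η, Q.eval x ≠ 0 := by
    intro x hx h
    have := hball x hx
    rw [h, zero_div] at this
    exact Complex.slitPlane_ne_zero this rfl
  have hρd : DifferentiableOn ℂ ρ (Metric.ball p η) := by
    intro x hx
    have h1 : DifferentiableAt ℂ (fun x => Complex.log (Q.eval x / Q.eval p)) x :=
      (Q.differentiable.differentiableAt.div_const _).clog (hball x hx)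
    exact ((h1.div_const 2).cexp.const_mul c).differentiableWithinAt
  obtain ⟨s, hs⟩ := hρd.isExactOn_ball
  refine ⟨Metric.ball p η, ρ, s, Metric.isOpen_ball, Metric.mem_ball_self hη, hne, ?_, hs⟩
  intro x hx
  have h0 : Q.eval x / Q.eval p ≠ 0 := div_ne_zero (hne x hx) hp
  simp only [ρ]
  rw [mul_pow, ← Complex.exp_nat_mul, hc]
  have : ((2 : ℕ) : ℂ) * (Complex.log (Q.eval x / Q.eval p) / 2) =
      Complex.log (Q.eval x / Q.eval p) := by push_cast; ring
  rw [this, Complex.exp_log h0]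
  field_simp

/-- Continuous induction downwards from `b`. The step may use all of `Icc t b ⊆ E`, not just `t ∈
E`; this lets an arc be compared with a line anchored at the right end point. -/
theorem Icc_subset_of_forall_exists_lt_of_Icc {E : Set ℝ} {a b : ℝ}
    (hE : IsClosed (E ∩ Icc a b)) (hb : b ∈ E)
    (hstep : ∀ t ∈ Ioc a b, Icc t b ⊆ E → ∃ t' < t, Ioc t' t ⊆ E) : Icc a b ⊆ E := by
  rcases lt_or_ge b a with hab | hab
  · rw [Icc_eq_empty (not_le.2 hab)]; exact empty_subset _
  let A : Set ℝ := {t | t ∈ Icc a b ∧ Icc t b ⊆ E}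
  have hbA : b ∈ A := ⟨⟨hab, le_rfl⟩, by simpa using hb⟩
  have hbdd : BddBelow A := ⟨a, fun t ht => ht.1.1⟩
  set c := sInf A
  have hac : a ≤ c := le_csInf ⟨b, hbA⟩ fun t ht => ht.1.1
  have hcb : c ≤ b := csInf_le hbdd hbA
  have hIoc : Ioc c b ⊆ E := by
    intro t ht
    obtain ⟨t', ht', ht't⟩ := exists_lt_of_csInf_lt ⟨b, hbA⟩ ht.1
    exact ht'.2 ⟨ht't.le, ht.2⟩
  have hcE : c ∈ E := by
    rcases hcb.eq_or_lt with h | h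
    · rwa [h]
    · have : closure (Ioc c b) ⊆ E ∩ Icc a b :=
        closure_minimal (fun t ht => ⟨hIoc ht, hac.trans ht.1.le, ht.2⟩) hE
      rw [closure_Ioc h.ne] at this
      exact (this ⟨le_rfl, hcb⟩).1
  have hIcc : Icc c b ⊆ E := by
    intro t ht
    rcases ht.1.eq_or_lt with h | h
    · rwa [← h]
    · exact hIoc ⟨h, ht.2⟩
  rcases hac.eq_or_lt with h | h
  · rwa [h]
  · exfalso
    obtain ⟨t', ht', hsub⟩ := hstep c ⟨h, hcb⟩ hIcc
    have hm : max t' a < c := max_lt ht' h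
    have : (max t' a + c) / 2 ∈ A := by
      have h1 : max t' a < (max t' a + c) / 2 := by linarith
      refine ⟨⟨(le_max_right t' a).trans h1.le, by linarith⟩, fun t ht => ?_⟩
      rcases le_or_gt t c with h2 | h2
      · exact hsub ⟨((le_max_left t' a).trans_lt h1).trans_le ht.1, h2⟩
      · exact hIcc ⟨h2.le, ht.2⟩
    have := csInf_le hbdd this
    change c ≤ _ at this
    linarith

/-- A function on an interval whose derivative takes the values `±1` only is affine. -/
theorem eq_add_mul_of_deriv_sq_eq_one {I : Set ℝ} (hI : Convex ℝ I) {f f' : ℝ → ℂ}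
    (hf : ∀ t ∈ I, HasDerivAt f (f' t) t) (hsq : ∀ t ∈ I, f' t ^ 2 = 1) {t₀ : ℝ} (h₀ : t₀ ∈ I) :
    ∀ t ∈ I, f t = f t₀ + f' t₀ * ((t - t₀ : ℝ) : ℂ) := by
  have hre : ∀ t ∈ I, HasDerivWithinAt (fun t => (f t).re) (f' t).re I t := fun t ht =>
    (Complex.reCLM.hasFDerivAt.comp_hasDerivAt t (hf t ht)).hasDerivWithinAt
  -- Darboux: a derivative has the intermediate value property, so one with values `±1` is constant
  -- without any continuity assumption.
  have hord := hI.ordConnected.image_hasDerivWithinAt hre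
  have hconst : ∀ t ∈ I, f' t = f' t₀ := by
    intro t ht
    have key : ∀ t₁ ∈ I, ∀ t₂ ∈ I, f' t₁ = 1 → f' t₂ = -1 → False := by
      intro t₁ h₁ t₂ h₂ e₁ e₂
      obtain ⟨t₃, h₃, e₃⟩ := hord.out ⟨t₂, h₂, rfl⟩ ⟨t₁, h₁, rfl⟩
        (show (0 : ℝ) ∈ Icc (f' t₂).re (f' t₁).re by rw [e₁, e₂]; norm_num)
      rcases sq_eq_one_iff.1 (hsq t₃ h₃) with h | h <;> simp [h] at e₃
    rcases sq_eq_one_iff.1 (hsq t ht) with h | h <;>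
    rcases sq_eq_one_iff.1 (hsq t₀ h₀) with h' | h'
    · rw [h, h']
    · exact (key t ht t₀ h₀ h h').elim
    · exact (key t₀ h₀ t ht h' h).elim
    · rw [h, h']
  intro t ht
  have h1 : ∀ t ∈ I, HasDerivWithinAt (fun t : ℝ => f t - f' t₀ * (t : ℂ)) 0 I t := by
    intro t ht
    have h2 : HasDerivAt (fun t : ℝ => f' t₀ * (t : ℂ)) (f' t₀ * 1) t :=
      (Complex.ofRealCLM.hasDerivAt (x := t)).const_mul _
    have h3 := (hf t ht).sub h2
    rw [hconst t ht, mul_one, sub_self] at h3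
    exact h3.hasDerivWithinAt
  have h2 := hI.norm_image_sub_le_of_norm_hasDerivWithin_le (C := 0) h1 (by simp) h₀ ht
  rw [zero_mul, norm_le_zero_iff, sub_eq_zero] at h2
  push_cast
  linear_combination h2

/-- A local coordinate `s = ∫ √Q` at `p` with inverse `z`, defined on the neighbourhood `N`. -/
structure IsChart (Q : Polynomial ℂ) (ρ s : ℂ → ℂ) (p : ℂ) (ε : ℝ) (z : ℂ → ℂ) (N : Set ℂ) :
    Prop extends IsLocalInverse s ρ N p ε z N where
  ne_zero : ∀ x ∈ N, Q.eval x ≠ 0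
  sq : ∀ x ∈ N, ρ x ^ 2 = Q.eval x
  deriv : ∀ x ∈ N, HasDerivAt s (ρ x) x

theorem exists_isChart (Q : Polynomial ℂ) {p : ℂ} (hp : Q.eval p ≠ 0) :
    ∃ ρ s ε z N, IsChart Q ρ s p ε z N := by
  obtain ⟨U, ρ, s, hU, hpU, hne, hsq, hs⟩ := exists_local_sqrt Q hp
  obtain ⟨ε, z, N, h⟩ := exists_isLocalInverse hU hs
    (fun x hx h => hne x hx (by rw [← hsq x hx, h]; simp)) hpU
  exact ⟨ρ, s, ε, z, N, ⟨h.pos, h.isOpen, h.mem, subset_rfl, h.mapsTo, h.mapsTo', h.right_inv,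
    h.left_inv, h.hasDerivAt⟩, fun x hx => hne x (h.subset hx), fun x hx => hsq x (h.subset hx),
    fun x hx => hs x (h.subset hx)⟩

section Chart

variable {Q : Polynomial ℂ} {ρ s z : ℂ → ℂ} {p : ℂ} {ε : ℝ} {N : Set ℂ}

theorem IsChart.ne_zero' (h : IsChart Q ρ s p ε z N) {x : ℂ} (hx : x ∈ N) : ρ x ≠ 0 := fun h0 =>
  h.ne_zero x hx (by rw [← h.sq x hx, h0]; simp)

/-- Horizontal lines in a chart, run through with speed `σ`. -/
theorem IsChart.hasDerivAt_line (h : IsChart Q ρ s p ε z N) {w σ : ℂ} {t₀ t : ℝ}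
    (ht : w + σ * ((t - t₀ : ℝ) : ℂ) ∈ Metric.ball (s p) ε) :
    HasDerivAt (fun t : ℝ => z (w + σ * ((t - t₀ : ℝ) : ℂ)))
      (σ / ρ (z (w + σ * ((t - t₀ : ℝ) : ℂ)))) t := by
  have h1 : HasDerivAt (fun t : ℝ => w + σ * ((t - t₀ : ℝ) : ℂ)) (σ * 1) t := by
    have h2 : HasDerivAt (fun t : ℝ => ((t - t₀ : ℝ) : ℂ)) 1 t := by
      exact_mod_cast ((hasDerivAt_id t).sub_const t₀).ofReal_comp
    exact (h2.const_mul σ).const_add w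
  have h2 := HasDerivAt.comp t (h.hasDerivAt _ ht) h1
  rw [mul_one, one_div_mul_eq_div] at h2
  exact h2

theorem IsChart.isOpen_line (_ : IsChart Q ρ s p ε z N) (w σ : ℂ) (t₀ : ℝ) :
    IsOpen {t : ℝ | w + σ * ((t - t₀ : ℝ) : ℂ) ∈ Metric.ball (s p) ε} :=
  Metric.isOpen_ball.preimage (by fun_prop)

theorem IsChart.convex_line (_ : IsChart Q ρ s p ε z N) (w σ : ℂ) (t₀ : ℝ) :
    Convex ℝ {t : ℝ | w + σ * ((t - t₀ : ℝ) : ℂ) ∈ Metric.ball (s p) ε} := by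
  intro t ht t' ht' a b ha hb hab
  have := convex_ball (s p) ε ht ht' ha hb hab
  simp only [mem_ofPred_eq] at this ⊢
  convert this using 1
  simp only [Complex.real_smul, smul_eq_mul]
  push_cast
  have hab' : (a : ℂ) + b = 1 := by exact_mod_cast hab
  linear_combination (-(w - σ * t₀)) * hab'

/-- A Stokes curve that passes through a chart runs along the whole horizontal line. -/
theorem mem_stokesGraph_of_horizontal (h : IsChart Q ρ s p ε z N) {g g' : ℂ}
    (hg : g ∈ stokesGraph Q) (hgN : g ∈ N) (hg'N : g' ∈ N) {τ : ℝ} (hτ : s g' = s g + τ) :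
    g' ∈ stokesGraph Q := by
  rcases hg with hg | ⟨a, T, γ, ha, hγ, t₀, ht₀, rfl⟩
  · exact (h.ne_zero g hgN hg).elim
  have ht₀pos : 0 < t₀ := by
    rcases ht₀.1.eq_or_lt with h0 | h0
    · rw [← h0, hγ.start] at hgN
      exact (h.ne_zero a hgN ha).elim
    · exact h0
  have ht₀I : t₀ ∈ Ioo 0 T := ⟨ht₀pos, ht₀.2⟩
  choose! v hv hvQ using hγ.deriv_sq
  set g := γ t₀
  -- `σ` is the direction in which the arc runs through the chart at `g`; `k` is the horizontal line
  -- with that direction, and `t₀ + θ` is the parameter at which it meets `g'`.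
  obtain ⟨σ, hσ, hσv⟩ : ∃ σ : ℝ, σ * σ = 1 ∧ (σ : ℂ) = ρ g * v t₀ := by
    have h1 : (ρ g * v t₀) ^ 2 = 1 := by rw [mul_pow, h.sq g hgN]; exact hvQ t₀ ht₀I
    rcases sq_eq_one_iff.1 h1 with h2 | h2
    · exact ⟨1, by norm_num, by rw [h2]; simp⟩
    · exact ⟨-1, by norm_num, by rw [h2]; simp⟩
  have hσ' : (σ : ℂ) * σ = 1 := by exact_mod_cast hσ
  set k : ℝ → ℂ := fun t => z (s g + σ * ((t - t₀ : ℝ) : ℂ)) with hk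
  set J := {t : ℝ | s g + σ * ((t - t₀ : ℝ) : ℂ) ∈ Metric.ball (s p) ε} with hJ
  have hJo : IsOpen J := h.isOpen_line _ _ _
  have hJc : J.OrdConnected := (h.convex_line (s g) σ t₀).ordConnected
  have hkJ : ∀ t ∈ J, HasDerivAt k (σ / ρ (k t)) t := fun t ht => h.hasDerivAt_line ht
  have hkN : ∀ t ∈ J, k t ∈ N := fun t ht => h.mapsTo _ ht
  have hksq : ∀ t ∈ J, Q.eval (k t) * (σ / ρ (k t)) ^ 2 = 1 := by
    intro t ht
    have h1 := h.ne_zero' (hkN t ht)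
    rw [← h.sq _ (hkN t ht)]
    field_simp
    rw [sq, hσ']
  have ht₀J : t₀ ∈ J := by simpa [hJ] using h.mapsTo' g hgN
  have hk₀ : k t₀ = g := by simpa [hk] using h.left_inv g hgN
  set θ := σ * τ with hθ
  have hτθ : (σ : ℂ) * ((t₀ + θ - t₀ : ℝ) : ℂ) = τ := by
    rw [hθ]; push_cast; linear_combination (τ : ℂ) * hσ'
  have hθJ : t₀ + θ ∈ J := by
    simp only [hJ, mem_ofPred_eq]
    rw [hτθ, ← hτ]
    exact h.mapsTo' g' hg'N
  have hkθ : k (t₀ + θ) = g' := by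
    simp only [hk]
    rw [hτθ, ← hτ]
    exact h.left_inv g' hg'N
  right
  rcases le_or_gt 0 θ with hθ0 | hθ0
  -- Here `g'` lies ahead: the arc is cut at `t₀` and continued along `k`. The slack `η` is needed
  -- because arcs are parametrized by half-open intervals.
  · obtain ⟨η, hη, hball⟩ := Metric.isOpen_iff.1 hJo _ hθJ
    have hIJ : Ico t₀ (t₀ + θ + η) ⊆ J := by
      intro t ht
      rcases le_total t (t₀ + θ) with h1 | h1
      · exact hJc.out ht₀J hθJ ⟨ht.1, h1⟩
      · apply hball
        rw [Metric.mem_ball, Real.dist_eq, abs_of_nonneg (by linarith)]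
        linarith [ht.2]
    let γ' : ℝ → ℂ := fun t => if t ≤ t₀ then γ t else k t
    have hlt : ∀ t < t₀, γ' =ᶠ[𝓝 t] γ := fun t ht => by
      filter_upwards [Iio_mem_nhds ht] with u hu
      exact if_pos (le_of_lt hu)
    have hgt : ∀ t > t₀, γ' =ᶠ[𝓝 t] k := fun t ht => by
      filter_upwards [Ioi_mem_nhds ht] with u hu
      exact if_neg (not_le.2 hu)
    have hd : ∀ t ∈ Ioo 0 (t₀ + θ + η), ∃ v : ℂ, HasDerivAt γ' v t ∧ Q.eval (γ' t) * v ^ 2 = 1 := by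
      intro t ht
      rcases lt_trichotomy t t₀ with h1 | h1 | h1
      · refine ⟨v t, (hv t ⟨ht.1, h1.trans ht₀.2⟩).congr_of_eventuallyEq (hlt t h1), ?_⟩
        rw [(hlt t h1).self_of_nhds]
        exact hvQ t ⟨ht.1, h1.trans ht₀.2⟩
      · subst h1
        have e1 : γ' t = g := if_pos le_rfl
        refine ⟨v t, ?_, ?_⟩
        · have d1 : HasDerivWithinAt γ' (v t) (Iic t) t :=
            (hv t ht₀I).hasDerivWithinAt.congr (fun u hu => if_pos hu) e1
          have d2 : HasDerivWithinAt γ' (v t) (Ici t) t := by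
            have e2 : (σ : ℂ) / ρ (k t) = v t := by
              rw [hk₀, hσv]
              field_simp [h.ne_zero' hgN]
            refine (e2 ▸ (hkJ t ht₀J).hasDerivWithinAt).congr (fun u hu => ?_) (e1.trans hk₀.symm)
            rcases (mem_Ici.1 hu).eq_or_lt with h2 | h2
            · rw [← h2, e1, hk₀]
            · exact if_neg (not_le.2 h2)
          have := d1.union d2
          rw [Iic_union_Ici] at this
          exact hasDerivWithinAt_univ.1 this
        · rw [e1]
          exact hvQ t ht₀I
      · have htJ : t ∈ J := hIJ ⟨h1.le, ht.2⟩
        refine ⟨_, (hkJ t htJ).congr_of_eventuallyEq (hgt t h1), ?_⟩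
        rw [(hgt t h1).self_of_nhds]
        exact hksq t htJ
    refine ⟨a, t₀ + θ + η, γ', ha, ⟨?_, ?_, hd⟩, t₀ + θ, ⟨by linarith, by linarith⟩, ?_⟩
    · exact (if_pos ht₀pos.le).trans hγ.start
    · intro t ht
      rcases ht.1.eq_or_lt with h1 | h1
      · subst h1
        have c1 : ContinuousWithinAt γ (Ico 0 (t₀ + θ + η)) 0 := by
          refine (hγ.cont 0 ⟨le_rfl, ht₀I.1.trans ht₀I.2⟩).mono_of_mem_nhdsWithin ?_
          refine mem_nhdsWithin.2 ⟨Iio T, isOpen_Iio, ht₀I.1.trans ht₀I.2, fun u hu => ⟨hu.2.1, hu.1⟩⟩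
        exact c1.congr_of_eventuallyEq (mem_nhdsWithin_of_mem_nhds (hlt 0 ht₀pos))
          (hlt 0 ht₀pos).self_of_nhds
      · obtain ⟨v', hv', -⟩ := hd t ⟨h1, ht.2⟩
        exact hv'.continuousAt.continuousWithinAt
    · rw [← hkθ]
      by_cases h1 : t₀ + θ ≤ t₀
      · have : θ = 0 := by linarith
        simp only [γ', this, add_zero, le_rfl, if_true, hk₀]
        rfl
      · exact if_neg h1
  -- Here `g'` lies behind, and the arc must already have passed it: going back from `t₀` it
  -- coincides with `k`. Were the parameter `0` reached before `g'`, the root `a` would lie in the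
  -- chart.
  · set t₁ := max 0 (t₀ + θ) with ht₁
    have ht₁₀ : t₁ ≤ t₀ := max_le ht₀pos.le (by linarith)
    have hIJ : Icc t₁ t₀ ⊆ J := fun t ht =>
      hJc.out hθJ ht₀J ⟨(le_max_right _ _).trans ht.1, ht.2⟩
    have hIT : Icc t₁ t₀ ⊆ Ico 0 T := fun t ht =>
      ⟨(le_max_left _ _).trans ht.1, ht.2.trans_lt ht₀.2⟩
    have hclosed : IsClosed ({t | γ t = k t} ∩ Icc t₁ t₀) := by
      have := (ContinuousOn.prodMk (hγ.cont.mono hIT) (fun t ht =>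
        (hkJ t (hIJ ht)).continuousAt.continuousWithinAt)).preimage_isClosed_of_isClosed
          isClosed_Icc isClosed_diagonal
      rw [inter_comm]
      exact this
    have hE : Icc t₁ t₀ ⊆ {t | γ t = k t} := by
      refine Icc_subset_of_forall_exists_lt_of_Icc hclosed hk₀.symm ?_
      intro t ht hsub
      have htT : t ∈ Ioo 0 T := ⟨(le_max_left _ _).trans_lt ht.1, ht.2.trans_lt ht₀.2⟩
      have htN : γ t ∈ N := by
        rw [hsub ⟨le_rfl, ht.2⟩]; exact hkN t (hIJ ⟨ht.1.le, ht.2⟩)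
      have hnear : ∀ᶠ u in 𝓝 t, γ u ∈ N ∧ u ∈ Ioo 0 T ∧ u ∈ J :=
        ((hv t htT).continuousAt.eventually_mem (h.isOpen.mem_nhds htN)).and
          ((isOpen_Ioo.eventually_mem htT).and (hJo.eventually_mem (hIJ ⟨ht.1.le, ht.2⟩)))
      obtain ⟨t', ht', hIoc⟩ := (mem_nhdsLE_iff_exists_Ioc_subset).1
        (mem_nhdsWithin_of_mem_nhds hnear : _ ∈ 𝓝[≤] t)
      refine ⟨t', ht', fun u hu => ?_⟩
      have hall : ∀ u ∈ Ioc t' t₀, γ u ∈ N ∧ u ∈ Ioo 0 T ∧ u ∈ J := by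
        intro u hu
        rcases le_or_gt u t with h1 | h1
        · exact hIoc ⟨hu.1, h1⟩
        · have hu' : u ∈ Icc t₁ t₀ := ⟨ht.1.le.trans h1.le, hu.2⟩
          refine ⟨?_, ⟨htT.1.trans h1, hu.2.trans_lt ht₀.2⟩, hIJ hu'⟩
          rw [hsub ⟨h1.le, hu.2⟩]
          exact hkN u (hIJ hu')
      have haff := eq_add_mul_of_deriv_sq_eq_one (convex_Ioc t' t₀) (f := fun u => s (γ u))
        (f' := fun u => ρ (γ u) * v u)
        (fun u hu => (h.deriv _ (hall u hu).1).comp u (hv u (hall u hu).2.1))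
        (fun u hu => by
          rw [mul_pow, h.sq _ (hall u hu).1]
          exact hvQ u (hall u hu).2.1) ⟨ht'.trans_le ht.2, le_rfl⟩ u ⟨hu.1, hu.2.trans ht.2⟩
      have hu' := hall u ⟨hu.1, hu.2.trans ht.2⟩
      change γ u = k u
      rw [← h.left_inv _ hu'.1, haff]
      simp only [hk]
      rw [hσv]
    have he := hE ⟨le_rfl, ht₁₀⟩
    rcases le_or_gt 0 (t₀ + θ) with h1 | h1
    · refine ⟨a, T, γ, ha, hγ, t₁, hIT ⟨le_rfl, ht₁₀⟩, ?_⟩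
      rw [← hkθ, he, ht₁, max_eq_right h1]
    · rw [ht₁, max_eq_left h1.le] at he hIJ
      exfalso
      have : a ∈ N := by
        rw [← hγ.start, he]
        exact hkN 0 (hIJ ⟨le_rfl, ht₀pos.le⟩)
      exact h.ne_zero a this ha

end Chart

/-! ### Elementary properties of Stokes domains -/

theorem mem_stokesGraph_of_isRoot {Q : Polynomial ℂ} {x : ℂ} (hx : Q.IsRoot x) :
    x ∈ stokesGraph Q := Or.inl hx

namespace IsStokesDomain

variable {Q : Polynomial ℂ} {Ω : Set ℂ}

theorem isOpen (h : IsStokesDomain Q Ω) : IsOpen Ω := by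
  obtain ⟨p, -, rfl⟩ := h
  exact isClosed_closure.isOpen_compl.connectedComponentIn

theorem isPreconnected (h : IsStokesDomain Q Ω) : IsPreconnected Ω := by
  obtain ⟨p, -, rfl⟩ := h
  exact isPreconnected_connectedComponentIn

theorem nonempty (h : IsStokesDomain Q Ω) : Ω.Nonempty := by
  obtain ⟨p, hp, rfl⟩ := h
  exact ⟨p, mem_connectedComponentIn hp⟩

theorem notMem_closure (h : IsStokesDomain Q Ω) {x : ℂ} (hx : x ∈ Ω) :
    x ∉ closure (stokesGraph Q) := by
  obtain ⟨p, -, rfl⟩ := h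
  exact connectedComponentIn_subset _ _ hx

theorem eval_ne_zero (h : IsStokesDomain Q Ω) {x : ℂ} (hx : x ∈ Ω) : Q.eval x ≠ 0 := fun h0 =>
  h.notMem_closure hx (subset_closure (mem_stokesGraph_of_isRoot h0))

theorem ne_zero (h : IsStokesDomain Q Ω) : Q ≠ 0 := by
  rintro rfl
  obtain ⟨x, hx⟩ := h.nonempty
  exact h.eval_ne_zero hx (by simp)

theorem degree_pos (h : IsStokesDomain Q Ω) {a : ℂ} (ha : Q.IsRoot a) : 0 < Q.degree :=
  Polynomial.degree_pos_of_root h.ne_zero ha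

theorem mem_of_mem_closure (h : IsStokesDomain Q Ω) {x : ℂ} (hx : x ∈ closure Ω)
    (hxG : x ∉ closure (stokesGraph Q)) : x ∈ Ω := by
  have hpre := h.isPreconnected
  have hdisj : ∀ y ∈ Ω, y ∉ closure (stokesGraph Q) := fun y hy => h.notMem_closure hy
  obtain ⟨p, hp, rfl⟩ := h
  set Ω := connectedComponentIn (closure (stokesGraph Q))ᶜ p
  have h1 : IsPreconnected (insert x Ω) :=
    hpre.subset_closure (subset_insert _ _) (insert_subset hx subset_closure)
  have h2 : insert x Ω ⊆ Ω := h1.subset_connectedComponentIn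
    (Or.inr (mem_connectedComponentIn hp)) (insert_subset hxG hdisj)
  exact h2 (Or.inl rfl)

theorem branch_ne_zero (h : IsStokesDomain Q Ω) {r : ℂ → ℂ} (hr : IsSqrtBranch Q Ω r) :
    ∀ x ∈ Ω, r x ≠ 0 := fun x hx h0 =>
  h.eval_ne_zero hx (by rw [← hr.sq x hx, h0]; simp)

end IsStokesDomain

/-! ### Lifting horizontal lines through `S` -/

/-- A bounded curve along which a nonzero polynomial tends to zero converges. -/
theorem exists_tendsto_of_tendsto_eval {P : Polynomial ℂ} (hP : P ≠ 0) {y : ℝ → ℂ} {a T B : ℝ}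
    (haT : a < T) (hcont : ContinuousOn y (Ico a T)) (hbdd : ∀ t ∈ Ico a T, ‖y t‖ ≤ B)
    (hlim : Tendsto (fun t => P.eval (y t)) (𝓝[<] T) (𝓝 0)) :
    ∃ p, Tendsto y (𝓝[<] T) (𝓝 p) := by
  have hIco : Ico a T ∈ 𝓝[<] T := Ico_mem_nhdsLT haT
  obtain ⟨p, -, hp⟩ := (isCompact_closedBall (0 : ℂ) B).exists_clusterPt
    (f := map y (𝓝[<] T)) (le_principal_iff.2 (mem_map.2 (by
      filter_upwards [hIco] with t ht
      simpa using hbdd t ht)))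
  refine ⟨p, Metric.tendsto_nhds.2 fun ε hε => ?_⟩
  have hfin : ({x | P.IsRoot x} \ {p}).Finite := (Polynomial.finite_setOfPred_isRoot hP).sdiff
  obtain ⟨ε₀, hε₀, hball⟩ := Metric.isOpen_iff.1 hfin.isClosed.isOpen_compl p (by simp)
  set η := min (ε / 2) (ε₀ / 2) with hη
  have hηpos : 0 < η := by positivity
  have hηε : η < ε := (min_le_left _ _).trans_lt (by linarith)
  have hηε₀ : η < ε₀ := (min_le_right _ _).trans_lt (by linarith)
  -- No zero of `P` lies on the circle of radius `η` about the cluster point `p`, so `|P| ≥ c > 0`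
  -- there. Once `|P(y)| < c`, the curve cannot cross this circle, and it is inside infinitely
  -- often.
  obtain ⟨c, hc, hcP⟩ := (isCompact_sphere p η).exists_forall_le' (f := fun x => ‖P.eval x‖)
    P.continuous.norm.continuousOn (a := 0) (by
      intro x hx
      rw [norm_pos_iff]
      intro h0
      have hd : dist x p = η := hx
      have hxb : x ∈ Metric.ball p ε₀ := by rw [Metric.mem_ball, hd]; exact hηε₀
      refine hball hxb ⟨h0, ?_⟩
      rintro rfl
      rw [dist_self] at hd
      exact hηpos.ne hd)
  have hsmall : ∀ᶠ t in 𝓝[<] T, ‖P.eval (y t)‖ < c := by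
    have := hlim.norm
    rw [norm_zero] at this
    exact this.eventually_lt_const hc
  obtain ⟨t₁, ht₁, hI⟩ := (mem_nhdsLT_iff_exists_Ioo_subset).1
    (inter_mem hsmall hIco)
  have hfreq : ∃ t ∈ Ioo t₁ T, y t ∈ Metric.ball p η := by
    have h1 := (mapClusterPt_iff_frequently.1 hp) _ (Metric.ball_mem_nhds p hηpos)
    obtain ⟨t, ht, ht'⟩ := (h1.and_eventually (Ioo_mem_nhdsLT ht₁)).exists
    exact ⟨t, ht', ht⟩
  obtain ⟨t₂, ht₂, hyt₂⟩ := hfreq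
  filter_upwards [Ioo_mem_nhdsLT ht₁] with t ht
  by_contra hlt
  have hd : ContinuousOn (fun t => dist (y t) p) (Ioo t₁ T) :=
    continuous_dist.comp_continuousOn
      ((hcont.mono fun u hu => (hI hu).2).prodMk continuousOn_const)
  obtain ⟨u, hu, hue⟩ := isPreconnected_Ioo.intermediate_value ht₂ ht hd
    ⟨(Metric.mem_ball.1 hyt₂).le, hηε.le.trans (not_lt.1 hlt)⟩
  exact (not_lt.2 (hcP (y u) hue)) (hI hu).1

/-- `y` lifts the horizontal segment `[S x, S x + T)` through `S`, starting at `x`. -/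
structure IsLift (Ω : Set ℂ) (S : ℂ → ℂ) (x : ℂ) (T : ℝ) (y : ℝ → ℂ) : Prop where
  start : y 0 = x
  cont : ContinuousOn y (Ico 0 T)
  mem : ∀ t ∈ Ico 0 T, y t ∈ Ω
  eq : ∀ t ∈ Ico 0 T, S (y t) = S x + t

/-- Uniqueness of lifts through a holomorphic function without critical points. -/
theorem eqOn_of_comp_eqOn {Ω : Set ℂ} {r S : ℂ → ℂ} (hΩ : IsOpen Ω)
    (hS : ∀ x ∈ Ω, HasDerivAt S (r x) x) (hr : ∀ x ∈ Ω, r x ≠ 0) {I : Set ℝ}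
    (hI : IsPreconnected I) {y₁ y₂ : ℝ → ℂ} (h₁ : ContinuousOn y₁ I) (h₂ : ContinuousOn y₂ I)
    (hm₁ : MapsTo y₁ I Ω) (hm₂ : MapsTo y₂ I Ω) (he : ∀ t ∈ I, S (y₁ t) = S (y₂ t))
    {t₀ : ℝ} (ht₀ : t₀ ∈ I) (h₀ : y₁ t₀ = y₂ t₀) : EqOn y₁ y₂ I := by
  have hinj : IsLocallyInjective (fun x : Ω => S x) := by
    rw [isLocallyInjective_iff_nhds]
    intro x
    obtain ⟨ε, z, N, h⟩ := exists_isLocalInverse hΩ hS hr x.2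
    refine ⟨Subtype.val ⁻¹' N, (h.isOpen.preimage continuous_subtype_val).mem_nhds h.mem, ?_⟩
    intro u hu v hv huv
    have : z (S u) = z (S v) := congrArg z huv
    rw [h.left_inv _ hu, h.left_inv _ hv] at this
    exact Subtype.ext this
  have : PreconnectedSpace I := isPreconnected_iff_preconnectedSpace.1 hI
  let g₁ : I → Ω := fun t => ⟨y₁ t, hm₁ t.2⟩
  let g₂ : I → Ω := fun t => ⟨y₂ t, hm₂ t.2⟩
  have hcomp : (fun x : Ω => S x) ∘ g₁ = (fun x : Ω => S x) ∘ g₂ := funext fun t => he t t.2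
  have := (T2Space.isSeparatedMap (fun x : Ω => S x)).eq_of_comp_eq hinj
    (h₁.domRestrict.subtype_mk _) (h₂.domRestrict.subtype_mk _) hcomp ⟨t₀, ht₀⟩ (Subtype.ext h₀)
  intro t ht
  exact congrArg Subtype.val (congrFun this ⟨t, ht⟩)

section Lift

variable {Q : Polynomial ℂ} {Ω : Set ℂ} {r S : ℂ → ℂ} {x : ℂ} {T : ℝ} {y : ℝ → ℂ}

theorem IsLift.hasDerivWithinAt (hΩ : IsOpen Ω) (hS : ∀ x ∈ Ω, HasDerivAt S (r x) x)
    (hr : ∀ x ∈ Ω, r x ≠ 0) (hy : IsLift Ω S x T y) {t : ℝ} (ht : t ∈ Ico 0 T) :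
    HasDerivWithinAt y (1 / r (y t)) (Ico 0 T) t := by
  obtain ⟨ε, z, N, h⟩ := exists_isLocalInverse hΩ hS hr (hy.mem t ht)
  have h1 : ∀ᶠ u in 𝓝[Ico 0 T] t, y u = z (S x + u) := by
    filter_upwards [(hy.cont t ht) (h.isOpen.mem_nhds h.mem), self_mem_nhdsWithin] with u hu hu'
    rw [← hy.eq u hu', h.left_inv _ hu]
  have h2 : HasDerivAt (fun u : ℝ => S x + (u : ℂ)) 1 t :=
    (Complex.ofRealCLM.hasDerivAt (x := t)).const_add _
  have hz := h.hasDerivAt (S (y t)) (Metric.mem_ball_self h.pos)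
  rw [h.left_inv _ h.mem, hy.eq t ht] at hz
  have h3 := HasDerivAt.comp t hz h2
  rw [mul_one] at h3
  refine h3.hasDerivWithinAt.congr_of_eventuallyEq h1 ?_
  change y t = z (S x + t)
  rw [← hy.eq t ht, h.left_inv _ h.mem]

theorem IsLift.hasDerivAt (hΩ : IsOpen Ω) (hS : ∀ x ∈ Ω, HasDerivAt S (r x) x)
    (hr : ∀ x ∈ Ω, r x ≠ 0) (hy : IsLift Ω S x T y) {t : ℝ} (ht : t ∈ Ioo 0 T) :
    HasDerivAt y (1 / r (y t)) t :=
  (hy.hasDerivWithinAt hΩ hS hr ⟨ht.1.le, ht.2⟩).hasDerivAt (Ico_mem_nhds ht.1 ht.2)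

/-- Outside a disc `|Q| ≥ 1`, so the speed `|y'| = 1 / |r|` is at most `1` there. The barrier grows
with speed `2` to make the comparison strict. -/
theorem IsLift.exists_bound (hΩ : IsStokesDomain Q Ω) (hQ : 0 < Q.degree)
    (hr : IsSqrtBranch Q Ω r) (hS : ∀ x ∈ Ω, HasDerivAt S (r x) x) (hy : IsLift Ω S x T y) :
    ∃ B, ∀ t ∈ Ico 0 T, ‖y t‖ ≤ B := by
  obtain ⟨R, hR⟩ : ∃ R : ℝ, ∀ w : ℂ, R ≤ ‖w‖ → 1 ≤ ‖Q.eval w‖ := by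
    have h1 := Q.tendsto_norm_atTop hQ (tendsto_norm_cobounded_atTop (E := ℂ))
    have h2 := h1.eventually_ge_atTop 1
    rw [← comap_norm_atTop, eventually_comap] at h2
    obtain ⟨R, hR⟩ := eventually_atTop.1 h2
    exact ⟨R, fun w hw => hR _ hw w rfl⟩
  refine ⟨max R ‖x‖ + 2 * T, fun t ht => ?_⟩
  have h1 := image_norm_le_of_norm_deriv_right_lt_deriv_boundary (f := y) (a := 0) (b := t)
    (f' := fun u => 1 / r (y u)) (B := fun u => max R ‖x‖ + 2 * u) (B' := fun _ => 2)
    (hy.cont.mono fun u hu => ⟨hu.1, hu.2.trans_lt ht.2⟩)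
    (fun u hu => (hy.hasDerivWithinAt hΩ.isOpen hS (hΩ.branch_ne_zero hr)
        ⟨hu.1, hu.2.trans ht.2⟩).mono_of_mem_nhdsWithin
      (mem_nhdsWithin.2 ⟨Iio T, isOpen_Iio, hu.2.trans ht.2, fun v hv => ⟨hu.1.trans hv.2, hv.1⟩⟩))
    (by simp [hy.start])
    (fun u => by simpa using ((hasDerivAt_id u).const_mul 2).const_add (max R ‖x‖))
    (fun u hu hue => by
      have hm := hy.mem u ⟨hu.1, hu.2.trans ht.2⟩
      have h2 : 1 ≤ ‖Q.eval (y u)‖ := hR _ (by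
        rw [hue]
        linarith [le_max_left R ‖x‖, hu.1])
      rw [← hr.sq _ hm, norm_pow] at h2
      have h3 : 1 ≤ ‖r (y u)‖ := by
        by_contra h4
        nlinarith [norm_nonneg (r (y u))]
      rw [norm_div, norm_one]
      have : 1 / ‖r (y u)‖ ≤ 1 := (div_le_one (by linarith)).2 h3
      linarith)
  have h2 := h1 ⟨ht.1, le_rfl⟩
  linarith [ht.2]

/-- The velocity `1 / r` may blow up at a turning point, but `(Q² ∘ y)' = 2 Q Q' / r = 2 r Q'` stays
bounded. So `Q² ∘ y` is Lipschitz and has a limit at `T`, and a nonconstant polynomial, `Q²` minus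
that limit, tends to zero along `y`. -/
theorem IsLift.exists_tendsto (hΩ : IsStokesDomain Q Ω) (hQ : 0 < Q.degree)
    (hr : IsSqrtBranch Q Ω r) (hS : ∀ x ∈ Ω, HasDerivAt S (r x) x) (hT : 0 < T)
    (hy : IsLift Ω S x T y) : ∃ p, Tendsto y (𝓝[<] T) (𝓝 p) := by
  obtain ⟨B, hB⟩ := hy.exists_bound hΩ hQ hr hS
  obtain ⟨C, hC⟩ := (isCompact_closedBall (0 : ℂ) B).exists_bound_of_continuousOn
    (f := fun w => 2 * (1 + ‖Q.eval w‖) * ‖Q.derivative.eval w‖)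
    (((continuous_const.mul (continuous_const.add Q.continuous.norm)).mul
      Q.derivative.continuous.norm).continuousOn)
  have hlip : LipschitzOnWith C.toNNReal (fun t => (Q ^ 2).eval (y t)) (Ico 0 T) := by
    refine (convex_Ico 0 T).lipschitzOnWith_of_nnnorm_hasDerivWithin_le
      (f' := fun t => (Q ^ 2).derivative.eval (y t) * (1 / r (y t))) ?_ ?_
    · intro t ht
      exact ((Q ^ 2).hasDerivAt (y t)).comp_hasDerivWithinAt t
        (hy.hasDerivWithinAt hΩ.isOpen hS (hΩ.branch_ne_zero hr) ht)
    · intro t ht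
      have hm := hy.mem t ht
      have hne := hΩ.branch_ne_zero hr _ hm
      rw [← NNReal.coe_le_coe, coe_nnnorm]
      have h1 := hC (y t) (by simpa using hB t ht)
      rw [Real.norm_of_nonneg (by positivity)] at h1
      refine le_trans ?_ (h1.trans (Real.le_coe_toNNReal C))
      have h2 : (Q ^ 2).derivative.eval (y t) * (1 / r (y t)) =
          2 * r (y t) * Q.derivative.eval (y t) := by
        rw [Polynomial.derivative_pow]
        simp only [Polynomial.eval_mul, Polynomial.eval_pow]
        rw [← hr.sq _ hm]
        simp
        field_simp
      rw [h2, norm_mul, norm_mul]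
      have h3 : ‖r (y t)‖ ≤ 1 + ‖Q.eval (y t)‖ := by
        rw [← hr.sq _ hm, norm_pow]
        nlinarith [sq_nonneg (‖r (y t)‖ - 1), norm_nonneg (r (y t))]
      have h4 : ‖(2 : ℂ)‖ = 2 := by simp
      rw [h4]
      gcongr
  obtain ⟨G, hG, hGe⟩ := hlip.extend_finite_dimension
  have hlim : Tendsto (fun t => (Q ^ 2).eval (y t)) (𝓝[<] T) (𝓝 (G T)) := by
    refine (hG.continuous.continuousAt.tendsto.mono_left nhdsWithin_le_nhds).congr' ?_
    filter_upwards [Ico_mem_nhdsLT hT] with t ht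
    exact (hGe ht).symm
  have hP : Q ^ 2 - Polynomial.C (G T) ≠ 0 := by
    intro h0
    have h1 : (Q ^ 2).degree ≤ 0 := by
      rw [sub_eq_zero.1 h0]; exact Polynomial.degree_C_le
    rw [Polynomial.degree_pow] at h1
    rw [two_nsmul] at h1
    exact absurd (hQ.trans_le (le_add_of_nonneg_right hQ.le)) (not_lt.2 h1)
  refine exists_tendsto_of_tendsto_eval hP hT hy.cont hB ?_
  have h1 := hlim.sub_const (G T)
  rw [sub_self] at h1
  simpa using h1

end Lift

section Lift

variable {Q : Polynomial ℂ} {Ω : Set ℂ} {r S : ℂ → ℂ} {x p : ℂ} {T : ℝ} {y : ℝ → ℂ}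

/-- A lift cannot run into a turning point: it would be part of a Stokes curve. -/
theorem IsLift.eval_ne_zero_of_tendsto (hΩ : IsStokesDomain Q Ω) (hr : IsSqrtBranch Q Ω r)
    (hS : ∀ x ∈ Ω, HasDerivAt S (r x) x) (hT : 0 < T) (hy : IsLift Ω S x T y)
    (hp : Tendsto y (𝓝[<] T) (𝓝 p)) : Q.eval p ≠ 0 := by
  intro h0
  have hrefl : Tendsto (fun t : ℝ => T - t) (𝓝[>] 0) (𝓝[<] T) := by
    refine tendsto_nhdsWithin_iff.2 ⟨?_, ?_⟩
    · have : Tendsto (fun t : ℝ => T - t) (𝓝 0) (𝓝 (T - 0)) :=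
        (continuous_const.sub continuous_id).tendsto 0
      rw [sub_zero] at this
      exact this.mono_left nhdsWithin_le_nhds
    · filter_upwards [self_mem_nhdsWithin] with t ht
      simpa using ht
  -- The lift run backwards. The value at `0` is imposed, since nothing is known about `y T`.
  let γ : ℝ → ℂ := Function.update (fun t => y (T - t)) 0 p
  have hγ : ∀ t, t ≠ 0 → γ =ᶠ[𝓝 t] fun t => y (T - t) := fun t ht => by
    filter_upwards [isOpen_ne.mem_nhds ht] with u hu
    exact Function.update_of_ne hu _ _
  have hd : ∀ t ∈ Ioo 0 T, HasDerivAt γ (-(1 / r (γ t))) t := by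
    intro t ht
    rw [(hγ t ht.1.ne').self_of_nhds]
    have h1 := (hy.hasDerivAt hΩ.isOpen hS (hΩ.branch_ne_zero hr) (t := T - t)
      ⟨by linarith [ht.2], by linarith [ht.1]⟩)
    have h2 := h1.scomp t ((hasDerivAt_id t).const_sub T)
    rw [neg_one_smul] at h2
    exact h2.congr_of_eventuallyEq (hγ t ht.1.ne')
  have hmem : ∀ t ∈ Ioo 0 T, γ t ∈ Ω := fun t ht => by
    rw [(hγ t ht.1.ne').self_of_nhds]
    exact hy.mem _ ⟨by linarith [ht.2], by linarith [ht.1]⟩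
  have harc : IsStokesArc Q p T γ := by
    refine ⟨Function.update_self _ _ _, fun t ht => ?_, fun t ht => ⟨_, hd t ht, ?_⟩⟩
    · rcases ht.1.eq_or_lt with h | h
      · rw [← h]
        refine continuousWithinAt_update_same.2 ?_
        refine (hp.comp hrefl).mono_left (nhdsWithin_mono _ ?_)
        rintro u ⟨hu, hu'⟩
        exact lt_of_le_of_ne hu.1 (Ne.symm hu')
      · exact (hd t ⟨h, ht.2⟩).continuousAt.continuousWithinAt
    · have h1 := hΩ.branch_ne_zero hr _ (hmem t ht)
      rw [← hr.sq _ (hmem t ht)]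
      field_simp
  have hT2 : T / 2 ∈ Ioo 0 T := ⟨by linarith, by linarith⟩
  exact hΩ.notMem_closure (hmem _ hT2)
    (subset_closure (Or.inr ⟨p, T, γ, h0, harc, T / 2, ⟨hT2.1.le, hT2.2⟩, rfl⟩))

/-- A lift cannot leave the Stokes domain, as the Stokes graph is locally a union of horizontal
lines. -/
theorem IsLift.mem_of_tendsto (hΩ : IsStokesDomain Q Ω) (hr : IsSqrtBranch Q Ω r)
    (hS : ∀ x ∈ Ω, HasDerivAt S (r x) x) (hT : 0 < T) (hy : IsLift Ω S x T y)
    (hp : Tendsto y (𝓝[<] T) (𝓝 p)) : p ∈ Ω := by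
  have hp0 := hy.eval_ne_zero_of_tendsto hΩ hr hS hT hp
  refine hΩ.mem_of_mem_closure (mem_closure_of_tendsto hp ?_) fun hpG => ?_
  · filter_upwards [Ico_mem_nhdsLT hT] with t ht using hy.mem t ht
  obtain ⟨ρ, s, ε, z, N, h⟩ := exists_isChart Q hp0
  obtain ⟨t₁, ht₁, hI⟩ := (mem_nhdsLT_iff_exists_Ioo_subset).1
    (inter_mem (hp (h.isOpen.mem_nhds h.mem)) (Ioo_mem_nhdsLT hT))
  set t₂ := (t₁ + T) / 2
  have ht₂ : t₂ ∈ Ioo t₁ T := ⟨by simp only [t₂]; linarith [mem_Iio.1 ht₁],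
    by simp only [t₂]; linarith [mem_Iio.1 ht₁]⟩
  have hΩne := hΩ.branch_ne_zero hr
  have hmem : ∀ t ∈ Ioo t₁ T, y t ∈ Ω := fun t ht => hy.mem t ⟨(hI ht).2.1.le, ht.2⟩
  have hsq : ∀ t ∈ Ioo t₁ T, (ρ (y t) * (1 / r (y t))) ^ 2 = 1 := by
    intro t ht
    have h1 := hΩne _ (hmem t ht)
    rw [mul_pow, h.sq _ (hI ht).1, ← hr.sq _ (hmem t ht)]
    field_simp
  have haff := eq_add_mul_of_deriv_sq_eq_one (convex_Ioo t₁ T) (f := fun t => s (y t))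
    (f' := fun t => ρ (y t) * (1 / r (y t)))
    (fun t ht => (h.deriv _ (hI ht).1).comp t (hy.hasDerivAt hΩ.isOpen hS hΩne (hI ht).2))
    hsq ht₂
  -- In the chart, `y t₂` and `p` lie on one horizontal line, so they differ by a real translation
  -- `κ`.
  obtain ⟨κ, hκ⟩ : ∃ κ : ℝ, s (y t₂) = s p + κ := by
    obtain ⟨σ, hσ⟩ : ∃ σ : ℝ, (σ : ℂ) = ρ (y t₂) * (1 / r (y t₂)) := by
      rcases sq_eq_one_iff.1 (hsq t₂ ht₂) with h2 | h2
      · exact ⟨1, by rw [h2]; simp⟩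
      · exact ⟨-1, by rw [h2]; simp⟩
    have l1 : Tendsto (fun t => s (y t)) (𝓝[<] T) (𝓝 (s p)) :=
      (h.deriv p h.mem).continuousAt.tendsto.comp hp
    have l2 : Tendsto (fun t : ℝ => s (y t₂) + σ * ((t - t₂ : ℝ) : ℂ)) (𝓝[<] T)
        (𝓝 (s (y t₂) + σ * ((T - t₂ : ℝ) : ℂ))) :=
      (Continuous.tendsto (by fun_prop) T).mono_left nhdsWithin_le_nhds
    have l3 := tendsto_nhds_unique l1 (l2.congr' (by
      filter_upwards [Ioo_mem_nhdsLT ht₁] with t ht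
      rw [haff t ht, hσ]))
    refine ⟨-(σ * (T - t₂)), ?_⟩
    rw [l3]
    push_cast
    ring
  have hx₂N : y t₂ ∈ N := (hI ht₂).1
  have hball : s p + κ ∈ Metric.ball (s p) ε := hκ ▸ h.mapsTo' _ hx₂N
  -- Translation by `κ` in the chart carries `p` to `y t₂` and Stokes points to Stokes points.
  -- Stokes points near `p` would thus be moved close to `y t₂`, which has a neighbourhood free of
  -- them.
  have hzc : ContinuousAt (fun q => z (s q + κ)) p := by
    have h1 : ContinuousAt (fun q => s q + (κ : ℂ)) p :=
      (h.deriv p h.mem).continuousAt.add continuousAt_const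
    exact (h.hasDerivAt _ hball).continuousAt.comp (f := fun q => s q + (κ : ℂ)) h1
  have hzp : z (s p + κ) = y t₂ := by rw [← hκ, h.left_inv _ hx₂N]
  have hO : (closure (stokesGraph Q))ᶜ ∈ 𝓝 (z (s p + κ)) := by
    rw [hzp]
    exact isClosed_closure.isOpen_compl.mem_nhds (hΩ.notMem_closure (hmem t₂ ht₂))
  have hnear : ∀ᶠ q in 𝓝 p, z (s q + κ) ∈ (closure (stokesGraph Q))ᶜ ∧ q ∈ N ∧
      s q + κ ∈ Metric.ball (s p) ε :=
    (hzc.eventually_mem hO).and ((h.isOpen.eventually_mem h.mem).and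
      (((h.deriv p h.mem).continuousAt.add continuousAt_const).eventually_mem
        (Metric.isOpen_ball.mem_nhds hball)))
  obtain ⟨q, hqG, hq⟩ := ((mem_closure_iff_frequently.1 hpG).and_eventually hnear).exists
  exact hq.1 (subset_closure (mem_stokesGraph_of_horizontal h hqG hq.2.1 (h.mapsTo _ hq.2.2)
    (h.right_inv _ hq.2.2)))

theorem IsLift.exists_extension (hΩ : IsStokesDomain Q Ω) (hQ : 0 < Q.degree)
    (hr : IsSqrtBranch Q Ω r) (hS : ∀ x ∈ Ω, HasDerivAt S (r x) x) (hT : 0 < T)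
    (hy : IsLift Ω S x T y) : ∃ T' > T, ∃ y', IsLift Ω S x T' y' := by
  obtain ⟨p, hp⟩ := hy.exists_tendsto hΩ hQ hr hS hT
  have hpΩ := hy.mem_of_tendsto hΩ hr hS hT hp
  obtain ⟨ε, z, N, h⟩ := exists_isLocalInverse hΩ.isOpen hS (hΩ.branch_ne_zero hr) hpΩ
  have hSp : S p = S x + T := by
    have l1 : Tendsto (fun t => S (y t)) (𝓝[<] T) (𝓝 (S p)) :=
      (hS p hpΩ).continuousAt.tendsto.comp hp
    have l2 : Tendsto (fun t : ℝ => S x + (t : ℂ)) (𝓝[<] T) (𝓝 (S x + T)) :=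
      (Continuous.tendsto (by fun_prop) T).mono_left nhdsWithin_le_nhds
    exact tendsto_nhds_unique l1 (l2.congr' (by
      filter_upwards [Ico_mem_nhdsLT hT] with t ht
      rw [hy.eq t ht]))
  obtain ⟨t₁, ht₁, hI⟩ := (mem_nhdsLT_iff_exists_Ioo_subset).1
    (inter_mem (hp (h.isOpen.mem_nhds h.mem)) (Ico_mem_nhdsLT hT))
  let y' : ℝ → ℂ := fun t => if t < T then y t else z (S x + t)
  have hz : ∀ t ∈ Ioo t₁ (T + ε), S x + t ∈ Metric.ball (S p) ε ∧ y' t = z (S x + t) := by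
    intro t ht
    by_cases h1 : t < T
    · have h2 := hI ⟨ht.1, h1⟩
      simp only [y', h1, if_true]
      rw [← hy.eq t h2.2]
      exact ⟨h.mapsTo' _ h2.1, (h.left_inv _ h2.1).symm⟩
    · simp only [y', h1, if_false, and_true]
      rw [hSp, Metric.mem_ball, dist_add_left, Complex.dist_of_im_eq (by simp), Complex.ofReal_re,
        Complex.ofReal_re, Real.dist_eq, abs_of_nonneg (by linarith)]
      linarith [ht.2]
  refine ⟨T + ε, by linarith [h.pos], y', (if_pos hT).trans hy.start, ?_, ?_, ?_⟩
  · intro t ht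
    rcases lt_or_ge t T with h1 | h1
    · have c1 : ContinuousWithinAt y (Ico 0 (T + ε)) t :=
        (hy.cont t ⟨ht.1, h1⟩).mono_of_mem_nhdsWithin
          (mem_nhdsWithin.2 ⟨Iio T, isOpen_Iio, h1, fun u hu => ⟨hu.2.1, hu.1⟩⟩)
      refine c1.congr_of_eventuallyEq (mem_nhdsWithin_of_mem_nhds ?_) (if_pos h1)
      filter_upwards [Iio_mem_nhds h1] with u hu
      exact if_pos hu
    · have htI : t ∈ Ioo t₁ (T + ε) := ⟨(mem_Iio.1 ht₁).trans_le h1, ht.2⟩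
      have c1 : ContinuousAt (fun u : ℝ => z (S x + u)) t :=
        ContinuousAt.comp (f := fun u : ℝ => S x + (u : ℂ))
          (h.hasDerivAt _ (hz t htI).1).continuousAt (by fun_prop)
      refine (c1.congr ?_).continuousWithinAt
      filter_upwards [Ioo_mem_nhds htI.1 htI.2] with u hu
      exact (hz u hu).2.symm
  · intro t ht
    rcases lt_or_ge t T with h1 | h1
    · simp only [y', h1, if_true]
      exact hy.mem t ⟨ht.1, h1⟩
    · have h2 := hz t ⟨(mem_Iio.1 ht₁).trans_le h1, ht.2⟩
      rw [h2.2]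
      exact h.subset (h.mapsTo _ h2.1)
  · intro t ht
    rcases lt_or_ge t T with h1 | h1
    · simp only [y', h1, if_true]
      exact hy.eq t ⟨ht.1, h1⟩
    · have h2 := hz t ⟨(mem_Iio.1 ht₁).trans_le h1, ht.2⟩
      rw [h2.2, h.right_inv _ h2.1]

theorem exists_isLift_pos (hΩ : IsOpen Ω) (hS : ∀ x ∈ Ω, HasDerivAt S (r x) x)
    (hr : ∀ x ∈ Ω, r x ≠ 0) (hx : x ∈ Ω) : ∃ T > 0, ∃ y, IsLift Ω S x T y := by
  obtain ⟨ε, z, N, h⟩ := exists_isLocalInverse hΩ hS hr hx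
  have hball : ∀ t ∈ Ico 0 ε, S x + ((t : ℝ) : ℂ) ∈ Metric.ball (S x) ε := by
    intro t ht
    rw [Metric.mem_ball, dist_eq_norm, add_sub_cancel_left, Complex.norm_real,
      Real.norm_of_nonneg ht.1]
    exact ht.2
  refine ⟨ε, h.pos, fun t => z (S x + t), ?_, fun t ht => ?_, fun t ht => ?_, fun t ht => ?_⟩
  · simpa using h.left_inv x h.mem
  · exact (ContinuousAt.comp (f := fun u : ℝ => S x + (u : ℂ))
      (h.hasDerivAt _ (hball t ht)).continuousAt (by fun_prop)).continuousWithinAt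
  · exact h.subset (h.mapsTo _ (hball t ht))
  · exact h.right_inv _ (hball t ht)

/-- Half-lines lift through `S`. -/
theorem exists_isLift_forall (hΩ : IsStokesDomain Q Ω) (hQ : 0 < Q.degree)
    (hr : IsSqrtBranch Q Ω r) (hS : ∀ x ∈ Ω, HasDerivAt S (r x) x) (hx : x ∈ Ω) :
    ∃ y, ∀ T, IsLift Ω S x T y := by
  have hne := hΩ.branch_ne_zero hr
  let A : Set ℝ := {T | ∃ y, IsLift Ω S x T y}
  -- `Y t` is some lift reaching beyond time `t`, if there is one. By uniqueness of lifts the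
  -- diagonal `Y t t` glues them all, and a finite supremum of lifting times would contradict
  -- extendability.
  have hchoice : ∀ t, ∃ y : ℝ → ℂ, ∀ T ∈ A, t < T → ∃ T' > t, IsLift Ω S x T' y := by
    intro t
    by_cases h : ∃ T ∈ A, t < T
    · obtain ⟨T, ⟨y, hy⟩, htT⟩ := h
      exact ⟨y, fun _ _ _ => ⟨T, htT, hy⟩⟩
    · exact ⟨fun _ => 0, fun T hT htT => (h ⟨T, hT, htT⟩).elim⟩
  choose Y hY using hchoice
  have hagree : ∀ T y, IsLift Ω S x T y → ∀ t ∈ Ico 0 T, Y t t = y t := by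
    intro T y hy t ht
    obtain ⟨T', hT', hy'⟩ := hY t T ⟨y, hy⟩ ht.2
    have hs1 : Icc 0 t ⊆ Ico 0 T' := fun u hu => ⟨hu.1, hu.2.trans_lt hT'⟩
    have hs2 : Icc 0 t ⊆ Ico 0 T := fun u hu => ⟨hu.1, hu.2.trans_lt ht.2⟩
    exact eqOn_of_comp_eqOn hΩ.isOpen hS hne isPreconnected_Icc (hy'.cont.mono hs1)
      (hy.cont.mono hs2) (fun u hu => hy'.mem u (hs1 hu)) (fun u hu => hy.mem u (hs2 hu))
      (fun u hu => by rw [hy'.eq u (hs1 hu), hy.eq u (hs2 hu)]) (t₀ := 0) ⟨le_rfl, ht.1⟩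
      (by rw [hy'.start, hy.start]) ⟨ht.1, le_rfl⟩
  obtain ⟨T₀, hT₀, y₀, hy₀⟩ := exists_isLift_pos hΩ.isOpen hS hne hx
  have hunion : ∀ T, (∀ t < T, ∃ T' ∈ A, t < T') → IsLift Ω S x T (fun t => Y t t) := by
    intro T hT
    refine ⟨?_, fun t ht => ?_, fun t ht => ?_, fun t ht => ?_⟩
    · rw [hagree T₀ y₀ hy₀ 0 ⟨le_rfl, hT₀⟩, hy₀.start]
    · obtain ⟨T', ⟨y, hy⟩, htT'⟩ := hT t ht.2
      have c1 : ContinuousWithinAt y (Ico 0 T) t :=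
        (hy.cont t ⟨ht.1, htT'⟩).mono_of_mem_nhdsWithin
          (mem_nhdsWithin.2 ⟨Iio T', isOpen_Iio, htT', fun u hu => ⟨hu.2.1, hu.1⟩⟩)
      refine c1.congr_of_eventuallyEq (mem_nhdsWithin.2 ⟨Iio T', isOpen_Iio, htT', fun u hu => ?_⟩)
        (hagree T' y hy t ⟨ht.1, htT'⟩)
      exact hagree T' y hy u ⟨hu.2.1, hu.1⟩
    · obtain ⟨T', ⟨y, hy⟩, htT'⟩ := hT t ht.2
      rw [hagree T' y hy t ⟨ht.1, htT'⟩]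
      exact hy.mem t ⟨ht.1, htT'⟩
    · obtain ⟨T', ⟨y, hy⟩, htT'⟩ := hT t ht.2
      rw [hagree T' y hy t ⟨ht.1, htT'⟩]
      exact hy.eq t ⟨ht.1, htT'⟩
  have hA : ¬BddAbove A := by
    intro hbdd
    have hT₀A : T₀ ∈ A := ⟨y₀, hy₀⟩
    have hlift := hunion (sSup A) fun t ht => exists_lt_of_lt_csSup ⟨T₀, hT₀A⟩ ht
    obtain ⟨T', hT', hy'⟩ := hlift.exists_extension hΩ hQ hr hS
      (hT₀.trans_le (le_csSup hbdd hT₀A))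
    exact (not_lt.2 (le_csSup hbdd hy')) hT'
  exact ⟨_, fun T => hunion T fun t _ => not_bddAbove_iff.1 hA t⟩

/-- Horizontal lines lift through `S`. -/
theorem exists_lift_line (hΩ : IsStokesDomain Q Ω) (hQ : 0 < Q.degree)
    (hr : IsSqrtBranch Q Ω r) (hS : ∀ x ∈ Ω, HasDerivAt S (r x) x) (hx : x ∈ Ω) :
    ∃ y : ℝ → ℂ, y 0 = x ∧ Continuous y ∧ ∀ t, y t ∈ Ω ∧ S (y t) = S x + t := by
  obtain ⟨y₁, h₁⟩ := exists_isLift_forall hΩ hQ hr hS hx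
  -- The negative half-line is a positive one for the opposite branch `-r` with primitive `-S`.
  obtain ⟨y₂, h₂⟩ := exists_isLift_forall (r := fun x => -r x) (S := fun x => -S x) hΩ hQ
    ⟨hr.holo.neg, fun x hx => by rw [neg_sq, hr.sq x hx]⟩ (fun x hx => (hS x hx).neg) hx
  have hcont : ∀ {y S'}, (∀ T, IsLift Ω S' x T y) → ContinuousOn y (Ici 0) := by
    intro y S' h t ht
    refine ((h (t + 1)).cont t ⟨ht, by linarith⟩).mono_of_mem_nhdsWithin
      (mem_nhdsWithin.2 ⟨Iio (t + 1), isOpen_Iio, by simp, fun u hu => ⟨hu.2, hu.1⟩⟩)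
  refine ⟨fun t => if 0 ≤ t then y₁ t else y₂ (-t), by simp [(h₁ 0).start], ?_, fun t => ?_⟩
  · refine continuous_if_le continuous_const continuous_id (hcont h₁) ?_ ?_
    · exact (hcont h₂).comp continuous_neg.continuousOn fun t ht => by simpa using ht
    · intro t ht
      change 0 = t at ht
      rw [← ht, neg_zero, (h₁ 0).start, (h₂ 0).start]
  · by_cases h : 0 ≤ t
    · simp only [h, if_true]
      exact ⟨(h₁ (t + 1)).mem t ⟨h, by linarith⟩, (h₁ (t + 1)).eq t ⟨h, by linarith⟩⟩
    · simp only [h, if_false]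
      have ht : -t ∈ Ico 0 (-t + 1) := ⟨by linarith, by linarith⟩
      refine ⟨(h₂ _).mem _ ht, ?_⟩
      have := (h₂ _).eq _ ht
      push_cast at this
      linear_combination -this

end Lift

/-! ### Injectivity of `S` -/

section Injective

variable {Ω : Set ℂ} {r S : ℂ → ℂ}

theorem isOpenMap_subtype (hΩ : IsOpen Ω) (hS : ∀ x ∈ Ω, HasDerivAt S (r x) x)
    (hr : ∀ x ∈ Ω, r x ≠ 0) : IsOpenMap (fun x : Ω => S x) := by
  refine isOpenMap_iff_nhds_le.2 fun x O hO => ?_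
  obtain ⟨ε, z, N, h⟩ := exists_isLocalInverse hΩ hS hr x.2
  have h1 : Subtype.val '' ((fun x : Ω => S x) ⁻¹' O) = Ω ∩ S ⁻¹' O := by
    ext; simp [and_comm]
  have h2 : Ω ∩ S ⁻¹' O ∈ 𝓝 (z (S x)) := by
    rw [h.left_inv _ h.mem, ← h1]
    exact (hΩ.isOpenMap_subtype_val.image_mem_nhds hO)
  have hmem : S x ∈ Metric.ball (S x) ε := Metric.mem_ball_self h.pos
  filter_upwards [(h.hasDerivAt _ hmem).continuousAt.eventually_mem h2,
    Metric.isOpen_ball.eventually_mem hmem] with w hw hw'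
  rw [← h.right_inv w hw']
  exact hw.2

theorem isLocallyInjective_subtype (hΩ : IsOpen Ω) (hS : ∀ x ∈ Ω, HasDerivAt S (r x) x)
    (hr : ∀ x ∈ Ω, r x ≠ 0) (x : Ω) : ∃ U ∈ 𝓝 x, InjOn (fun x : Ω => S x) U := by
  obtain ⟨ε, z, N, h⟩ := exists_isLocalInverse hΩ hS hr x.2
  refine ⟨Subtype.val ⁻¹' N, (h.isOpen.preimage continuous_subtype_val).mem_nhds h.mem, ?_⟩
  intro u hu v hv huv
  have : z (S u) = z (S v) := congrArg z huv
  rw [h.left_inv _ hu, h.left_inv _ hv] at this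
  exact Subtype.ext this

theorem continuous_subtype (hS : ∀ x ∈ Ω, HasDerivAt S (r x) x) :
    Continuous (fun x : Ω => S x) :=
  continuousOn_iff_continuous_domRestrict.1 fun x hx =>
    (hS x hx).continuousAt.continuousWithinAt

theorem isLocalHomeomorph_subtype (hΩ : IsOpen Ω) (hS : ∀ x ∈ Ω, HasDerivAt S (r x) x)
    (hr : ∀ x ∈ Ω, r x ≠ 0) : IsLocalHomeomorph (fun x : Ω => S x) := by
  refine isLocalHomeomorph_iff_isOpenEmbedding_restrict.2 fun x => ?_
  obtain ⟨U, hU, hUi⟩ := isLocallyInjective_subtype hΩ hS hr x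
  obtain ⟨V, hVU, hV, hxV⟩ := mem_nhds_iff.1 hU
  refine ⟨V, hV.mem_nhds hxV, .of_continuous_injective_isOpenMap
    ((continuous_subtype hS).comp continuous_subtype_val) (injOn_iff_injective.1 (hUi.mono hVU))
    ((isOpenMap_subtype hΩ hS hr).comp hV.isOpenMap_subtype_val)⟩

/-- If all horizontal lines lift through `S`, then `S` is injective. -/
theorem injOn_of_exists_lift_line (hΩ : IsOpen Ω) (hΩc : IsPreconnected Ω)
    (hS : ∀ x ∈ Ω, HasDerivAt S (r x) x) (hr : ∀ x ∈ Ω, r x ≠ 0)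
    (hline : ∀ x ∈ Ω, ∃ y : ℝ → ℂ, y 0 = x ∧ Continuous y ∧ ∀ t, y t ∈ Ω ∧ S (y t) = S x + t) :
    InjOn S Ω := by
  have hline' : ∀ x : Ω, ∃ y : ℝ → Ω, y 0 = x ∧ Continuous y ∧ ∀ t, S (y t) = S x + t := by
    intro x
    obtain ⟨y, h0, hc, h⟩ := hline x x.2
    exact ⟨fun t => ⟨y t, (h t).1⟩, Subtype.ext h0, hc.subtype_mk _, fun t => (h t).2⟩
  choose φ hφ0 hφc hφS using hline'
  set P : Ω → ℂ := fun x => S x with hP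
  have hPc : Continuous P := continuous_subtype hS
  have hPo : IsOpenMap P := isOpenMap_subtype hΩ hS hr
  have hPl : IsLocalHomeomorph P := isLocalHomeomorph_subtype hΩ hS hr
  have hsep : IsSeparatedMap P := T2Space.isSeparatedMap P
  -- Joint continuity by homotopy lifting: `u ↦ φ x (u t)` lifts the path `u ↦ S x + u t` with
  -- starting point depending continuously on `(x, t)`. The claim is the case `u = 1`.
  have hφ : Continuous fun q : Ω × ℝ => φ q.1 q.2 := by
    let f : C(unitInterval × (Ω × ℝ), ℂ) :=
      ⟨fun q => P q.2.1 + ((q.1.1 * q.2.2 : ℝ) : ℂ), by fun_prop⟩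
    have h1 := hPl.continuous_lift hsep f (g := fun q => φ q.2.1 (q.1.1 * q.2.2))
      (funext fun q => hφS _ _) (by simpa [hφ0] using continuous_fst)
      (fun a => (hφc a.1).comp (by fun_prop))
    have h2 := h1.comp (Continuous.prodMk_right (1 : unitInterval))
    simpa [Function.comp_def] using h2
  -- The section `Re S = 0` is the image of `Ω` under the flow map `ρ`, hence connected. On it `Im
  -- S` is open and locally injective, hence injective. A point is recovered from its foot `ρ x` and
  -- from `Re S x`.
  let Z := {x : Ω // (P x).re = 0}
  let ρ : Ω → Z := fun x => ⟨φ x (-(P x).re), by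
    change (S (φ x (-(P x).re))).re = 0
    rw [hφS]
    simp [hP]⟩
  have hρP : ∀ x, (P (ρ x).1).im = (P x).im := fun x => by
    change (S (φ x (-(P x).re))).im = _
    rw [hφS]
    simp [hP]
  have hρc : Continuous ρ :=
    (hφ.comp (continuous_id.prodMk (Complex.continuous_re.comp hPc).neg)).subtype_mk _
  have hρs : Function.Surjective ρ := by
    rintro ⟨x, hx⟩
    refine ⟨x, Subtype.ext ?_⟩
    change φ x (-(P x).re) = x
    rw [hx, neg_zero, hφ0]
  have hΩp : PreconnectedSpace Ω := isPreconnected_iff_preconnectedSpace.1 hΩc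
  have hZ : PreconnectedSpace Z := ⟨by
    rw [← hρs.range_eq]; exact isPreconnected_range hρc⟩
  let q : Z → ℝ := fun z => (P z.1).im
  have hq : Function.Injective q := by
    refine injective_of_isOpenMap_real
      (Complex.continuous_im.comp (hPc.comp continuous_subtype_val)) ?_ ?_
    · refine isOpenMap_iff_nhds_le.2 fun x O hO => ?_
      rw [mem_map, nhds_subtype_eq_comap, mem_comap] at hO
      obtain ⟨W, hW, hWO⟩ := hO
      have h1 := hPo.image_mem_nhds hW
      have h2 : ContinuousAt (fun s : ℝ => (s : ℂ) * Complex.I) (q x) := by fun_prop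
      have h3 : ((q x : ℝ) : ℂ) * Complex.I = P x.1 := by
        apply Complex.ext <;> simp [q, x.2]
      rw [← h3] at h1
      filter_upwards [h2 h1] with s hs
      obtain ⟨o, ho, hos⟩ := hs
      have h4 : (P o).re = 0 := by rw [hos]; simp
      have h5 : q ⟨o, h4⟩ ∈ O := hWO (a := (⟨o, h4⟩ : Z)) ho
      have h6 : q ⟨o, h4⟩ = s := by
        change (P o).im = s
        rw [hos]; simp
      rwa [← h6]
    · intro x
      obtain ⟨U, hU, hUi⟩ := isLocallyInjective_subtype hΩ hS hr x.1
      refine ⟨Subtype.val ⁻¹' U, continuous_subtype_val.continuousAt.preimage_mem_nhds hU, ?_⟩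
      intro u hu v hv huv
      refine Subtype.ext (hUi hu hv (Complex.ext ?_ huv))
      exact u.2.trans v.2.symm
  intro x₁ h₁ x₂ h₂ h12
  have e1 : ρ ⟨x₁, h₁⟩ = ρ ⟨x₂, h₂⟩ := hq (by
    change (P (ρ ⟨x₁, h₁⟩).1).im = (P (ρ ⟨x₂, h₂⟩).1).im
    rw [hρP, hρP]
    exact congrArg Complex.im h12)
  have e2 : ∀ x : Ω, φ (ρ x).1 (P x).re = x := by
    intro x
    have h3 := hsep.eq_of_comp_eq hPl.isLocallyInjective (g₁ := fun t => φ (ρ x).1 t)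
      (g₂ := fun t => φ x (t - (P x).re)) (hφc _) ((hφc _).comp (by fun_prop)) (by
        funext t
        change S (φ (ρ x).1 t) = S (φ x (t - (P x).re))
        have h4 : S (ρ x).1 = S x + ((-(P x).re : ℝ) : ℂ) := hφS _ _
        rw [hφS (ρ x).1 t, hφS x (t - (P x).re), h4]
        push_cast
        ring) 0 (by
        rw [hφ0, zero_sub])
    have h4 := congrFun h3 (P x).re
    simp only [sub_self, hφ0] at h4
    exact h4
  have e3 := e2 ⟨x₁, h₁⟩
  have e4 := e2 ⟨x₂, h₂⟩
  have e5 : P ⟨x₁, h₁⟩ = P ⟨x₂, h₂⟩ := h12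
  rw [e1, e5] at e3
  exact congrArg Subtype.val (e3.symm.trans e4)

end Injective

/-! ### The biholomorphic map onto the strip -/

/-- The strip (or half-plane) `0 < Im w < μ`. -/
def strip (μ : EReal) : Set ℂ := {w | 0 < w.im ∧ ((w.im : ℝ) : EReal) < μ}

/-- `ψ` is the inverse of the biholomorphic map `S : Ω → {0 < Im w < μ}`, with `S' = r`. -/
structure IsGlobalInverse (Ω : Set ℂ) (r S : ℂ → ℂ) (ψ : ℂ → ℂ) : Prop where
  isOpen : IsOpen Ω
  ne_zero : ∀ x ∈ Ω, r x ≠ 0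
  deriv : ∀ x ∈ Ω, HasDerivAt S (r x) x
  mapsTo : ∀ x ∈ Ω, S x ∈ strip (mu Ω S)
  left_inv : ∀ x ∈ Ω, ψ (S x) = x
  mem : ∀ w ∈ strip (mu Ω S), ψ w ∈ Ω
  right_inv : ∀ w ∈ strip (mu Ω S), S (ψ w) = w
  hasDerivAt : ∀ w ∈ strip (mu Ω S), HasDerivAt ψ (1 / r (ψ w)) w

/-- `Im S` does not attain its supremum, as `S` takes all values near each of its values, and it
comes arbitrarily close to `0` near `a`. By connectedness it takes every value in between; the
lifted horizontal line through such a point then reaches any prescribed real part. -/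
theorem exists_isGlobalInverse {Q : Polynomial ℂ} {Ω : Set ℂ} {a : ℂ} {r S : ℂ → ℂ}
    (hΩ : IsStokesDomain Q Ω) (ha : Q.IsRoot a) (haΩ : a ∈ frontier Ω)
    (hr : IsSqrtBranch Q Ω r) (hS : IsIntegralFrom Ω a r S) (hpos : ∀ x ∈ Ω, 0 < (S x).im) :
    ∃ ψ, IsGlobalInverse Ω r S ψ := by
  have hd := hS.hasDerivAt
  have hne := hΩ.branch_ne_zero hr
  have hline : ∀ x ∈ Ω, ∃ y : ℝ → ℂ, y 0 = x ∧ Continuous y ∧ ∀ t, y t ∈ Ω ∧ S (y t) = S x + t :=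
    fun x hx => exists_lift_line hΩ (hΩ.degree_pos ha) hr hd hx
  have hinj := injOn_of_exists_lift_line hΩ.isOpen hΩ.isPreconnected hd hne hline
  have hSc : ContinuousOn S Ω := fun x hx => (hd x hx).continuousAt.continuousWithinAt
  have hmaps : ∀ x ∈ Ω, S x ∈ strip (mu Ω S) := by
    intro x hx
    refine ⟨hpos x hx, ?_⟩
    obtain ⟨ε, z, N, h⟩ := exists_isLocalInverse hΩ.isOpen hd hne hx
    have hw : S x + (ε / 2 : ℝ) * Complex.I ∈ Metric.ball (S x) ε := by
      rw [Metric.mem_ball, dist_eq_norm, add_sub_cancel_left, norm_mul, Complex.norm_I, mul_one,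
        Complex.norm_real, Real.norm_of_nonneg (by linarith [h.pos])]
      linarith [h.pos]
    have h1 : (((S (z (S x + (ε / 2 : ℝ) * Complex.I))).im : ℝ) : EReal) ≤ mu Ω S :=
      le_iSup₂ (f := fun (x : ℂ) (_ : x ∈ Ω) => (((S x).im : ℝ) : EReal)) _
        (h.subset (h.mapsTo _ hw))
    rw [h.right_inv _ hw] at h1
    refine lt_of_lt_of_le (EReal.coe_lt_coe_iff.2 ?_) h1
    simp [h.pos]
  have hsurj : ∀ w ∈ strip (mu Ω S), ∃ x ∈ Ω, S x = w := by
    intro w hw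
    obtain ⟨x₁, hx₁, h₁⟩ : ∃ x ∈ Ω, (S x).im ≤ w.im := by
      have hcl : (𝓝[Ω] a).NeBot := mem_closure_iff_nhdsWithin_neBot.1 haΩ.1
      have h1 : Tendsto (fun x => (S x).im) (𝓝[Ω] a) (𝓝 0) := by
        have := (Complex.continuous_im.tendsto 0).comp hS.vanish
        simpa [Function.comp_def] using this
      obtain ⟨x, hx, hx'⟩ := ((h1.eventually_lt_const hw.1).and self_mem_nhdsWithin).exists
      exact ⟨x, hx', hx.le⟩
    obtain ⟨x₂, hx₂, h₂⟩ : ∃ x ∈ Ω, w.im ≤ (S x).im := by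
      obtain ⟨x, hx⟩ := lt_iSup_iff.1 hw.2
      obtain ⟨hxΩ, hx⟩ := lt_iSup_iff.1 hx
      exact ⟨x, hxΩ, (EReal.coe_lt_coe_iff.1 hx).le⟩
    obtain ⟨x, hx, hxe⟩ := hΩ.isPreconnected.intermediate_value hx₁ hx₂
      (Complex.continuous_im.comp_continuousOn hSc) ⟨h₁, h₂⟩
    obtain ⟨y, -, -, hy⟩ := hline x hx
    refine ⟨y (w.re - (S x).re), (hy _).1, ?_⟩
    rw [(hy _).2]
    change (S x).im = w.im at hxe
    apply Complex.ext <;> simp [hxe]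
  let ψ := Function.invFunOn S Ω
  have hψm : ∀ w ∈ strip (mu Ω S), ψ w ∈ Ω := fun w hw => Function.invFunOn_mem (hsurj w hw)
  have hψr : ∀ w ∈ strip (mu Ω S), S (ψ w) = w := fun w hw => Function.invFunOn_eq (hsurj w hw)
  have hψl : ∀ x ∈ Ω, ψ (S x) = x := fun x hx => hinj.leftInvOn_invFunOn hx
  refine ⟨ψ, hΩ.isOpen, hne, hd, hmaps, hψl, hψm, hψr, fun w hw => ?_⟩
  obtain ⟨ε, z, N, h⟩ := exists_isLocalInverse hΩ.isOpen hd hne (hψm w hw)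
  have hb := h.hasDerivAt (S (ψ w)) (Metric.mem_ball_self h.pos)
  rw [h.left_inv _ h.mem, hψr w hw] at hb
  refine hb.congr_of_eventuallyEq ?_
  have hwb : w ∈ Metric.ball (S (ψ w)) ε := by
    rw [hψr w hw]; exact Metric.mem_ball_self h.pos
  filter_upwards [Metric.isOpen_ball.eventually_mem hwb] with u hu
  rw [← hψl _ (h.subset (h.mapsTo u hu)), h.right_inv u hu]

namespace IsGlobalInverse

variable {Ω : Set ℂ} {r S ψ : ℂ → ℂ}

theorem add_mem_strip {μ : EReal} {w : ℂ} (hw : w ∈ strip μ) (t : ℝ) : w + t ∈ strip μ := by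
  simpa [strip] using hw

theorem isTrajectory (h : IsGlobalInverse Ω r S ψ) {x : ℂ} (hx : x ∈ Ω) :
    IsTrajectory Ω r x (fun t => ψ (S x + t)) := by
  refine ⟨by simpa using h.left_inv x hx, fun t => ?_⟩
  have hm := add_mem_strip (h.mapsTo x hx) t
  refine ⟨h.mem _ hm, ?_⟩
  have h2 : HasDerivAt (fun u : ℝ => S x + (u : ℂ)) 1 t :=
    (Complex.ofRealCLM.hasDerivAt (x := t)).const_add _
  have h3 := HasDerivAt.comp t (h.hasDerivAt _ hm) h2
  rw [mul_one] at h3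
  exact h3

/-- `flow` rests on an arbitrary choice of a trajectory. The choice is harmless: `S ∘ y` has
derivative `1` along every trajectory. -/
theorem eq_of_isTrajectory (h : IsGlobalInverse Ω r S ψ) {x : ℂ} {y : ℝ → ℂ}
    (hy : IsTrajectory Ω r x y) (t : ℝ) : y t = ψ (S x + t) := by
  have h1 : ∀ t ∈ (univ : Set ℝ), HasDerivAt (fun t => S (y t)) 1 t := by
    intro t _
    have h2 := (h.deriv _ (hy.2 t).1).comp t (hy.2 t).2
    rwa [mul_one_div_cancel (h.ne_zero _ (hy.2 t).1)] at h2
  have h3 := eq_add_mul_of_deriv_sq_eq_one convex_univ h1 (by simp) (mem_univ 0) t (mem_univ t)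
  simp only [hy.1, sub_zero, one_mul] at h3
  rw [← h3, h.left_inv _ (hy.2 t).1]

theorem flow_eq (h : IsGlobalInverse Ω r S ψ) {x : ℂ} (hx : x ∈ Ω) (t : ℝ) :
    flow Ω r t x = ψ (S x + t) := by
  have hex : ∃ y, IsTrajectory Ω r x y := ⟨_, h.isTrajectory hx⟩
  rw [flow, dif_pos hex]
  exact h.eq_of_isTrajectory hex.choose_spec t

theorem isTrajectory_flow (h : IsGlobalInverse Ω r S ψ) {x : ℂ} (hx : x ∈ Ω) :
    IsTrajectory Ω r x (fun t => flow Ω r t x) := by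
  simpa only [h.flow_eq hx] using h.isTrajectory hx

end IsGlobalInverse

/-! ### Boundedness of `C / Q` on smaller strips -/

/-- The smaller strip `δ < Im w < μ - δ`. -/
def substrip (μ : EReal) (δ : ℝ) : Set ℂ := {w | δ < w.im ∧ ((w.im + δ : ℝ) : EReal) < μ}

theorem mem_subdomain_iff {Ω : Set ℂ} {S : ℂ → ℂ} {δ : ℝ} {x : ℂ} :
    x ∈ subdomain Ω S δ ↔ x ∈ Ω ∧ S x ∈ substrip (mu Ω S) δ := by
  have : (((S x).im : ℝ) : EReal) < mu Ω S - (δ : EReal) ↔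
      (((S x).im + δ : ℝ) : EReal) < mu Ω S := by
    rw [EReal.coe_add]
    exact EReal.lt_sub_iff_add_lt (Or.inl (EReal.coe_ne_bot δ)) (Or.inl (EReal.coe_ne_top δ))
  simp only [subdomain, substrip, mem_ofPred_eq, this]

theorem substrip_subset_strip {μ : EReal} {δ : ℝ} (hδ : 0 ≤ δ) : substrip μ δ ⊆ strip μ :=
  fun _ hw => ⟨hδ.trans_lt hw.1, lt_of_le_of_lt (EReal.coe_le_coe_iff.2 (by linarith)) hw.2⟩

theorem closedBall_subset_substrip {μ : EReal} {δ η : ℝ} {w : ℂ} (hw : w ∈ substrip μ δ) :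
    Metric.closedBall w η ⊆ substrip μ (δ - η) := by
  intro u hu
  have h1 : |(u - w).im| ≤ η :=
    (Complex.abs_im_le_norm _).trans (by rw [← dist_eq_norm]; exact hu)
  rw [Complex.sub_im, abs_le] at h1
  exact ⟨by linarith [hw.1, h1.1],
    lt_of_le_of_lt (EReal.coe_le_coe_iff.2 (by linarith [h1.2])) hw.2⟩

theorem exists_mem_substrip {μ : EReal} {w : ℂ} (hw : w ∈ strip μ) :
    ∃ δ > 0, w ∈ substrip μ δ := by
  obtain ⟨c, hc, hcμ⟩ := EReal.lt_iff_exists_real_btwn.1 hw.2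
  have hc' : w.im < c := EReal.coe_lt_coe_iff.1 hc
  refine ⟨min (w.im / 2) (c - w.im), lt_min (by linarith [hw.1]) (by linarith), ?_, ?_⟩
  · exact (min_le_left _ _).trans_lt (by linarith [hw.1])
  · refine lt_of_le_of_lt (EReal.coe_le_coe_iff.2 ?_) hcμ
    linarith [min_le_right (w.im / 2) (c - w.im)]

theorem isOpen_strip (μ : EReal) : IsOpen (strip μ) :=
  (isOpen_lt continuous_const Complex.continuous_im).inter
    (isOpen_lt (continuous_coe_real_ereal.comp Complex.continuous_im) continuous_const)

theorem isOpen_substrip (μ : EReal) (δ : ℝ) : IsOpen (substrip μ δ) :=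
  (isOpen_lt continuous_const Complex.continuous_im).inter
    (isOpen_lt (continuous_coe_real_ereal.comp (Complex.continuous_im.add continuous_const))
      continuous_const)

theorem add_mem_substrip {μ : EReal} {δ : ℝ} {w : ℂ} (hw : w ∈ substrip μ δ) (t : ℝ) :
    w + t ∈ substrip μ δ := by
  simpa [substrip] using hw

/-- Points of `Ω_δ` stay away from the zeros of `Q`. -/
theorem IsGlobalInverse.exists_le_dist_root {Q : Polynomial ℂ} {Ω : Set ℂ} {r S ψ : ℂ → ℂ}
    (h : IsGlobalInverse Ω r S ψ) (hr : IsSqrtBranch Q Ω r) (hQ : Q ≠ 0)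
    (hroot : ∀ b, Q.IsRoot b → b ∉ Ω) {δ : ℝ} (hδ : 0 < δ) :
    ∃ ε > 0, ∀ x ∈ Ω, S x ∈ substrip (mu Ω S) δ → ∀ b, Q.IsRoot b → ε ≤ dist x b := by
  obtain ⟨R, hR⟩ := (Polynomial.finite_setOfPred_isRoot hQ).isBounded.exists_norm_le
  obtain ⟨M, hM⟩ := (isCompact_closedBall (0 : ℂ) (R + 2)).exists_bound_of_continuousOn
    Q.continuous.continuousOn
  set L := 1 + |M| with hL
  have hLpos : 0 < L := by positivity
  -- The bound `1` keeps the discs used below inside the disc of radius `R + 2`, where `|r| ≤ L`.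
  -- The other bound makes `S` vary by at most `δ / 2` on them.
  refine ⟨min 1 (δ / (2 * L)), by positivity, fun x hx hxδ b hb => ?_⟩
  by_contra hlt
  rw [not_le] at hlt
  have hcl : IsClosed Ωᶜ := h.isOpen.isClosed_compl
  -- `c` is a point of the complement nearest to `x`, at distance `ρ ≤ dist x b`. The open disc of
  -- radius `ρ` lies in the compact set `ψ(closedBall (S x) (δ/2)) ⊆ Ω`. So does its closure, which
  -- contains `c`: a contradiction.
  obtain ⟨c, hc, hcd⟩ := hcl.exists_infDist_eq_dist ⟨b, hroot b hb⟩ x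
  set ρ := Metric.infDist x Ωᶜ with hρ
  have hρb : ρ ≤ dist x b := Metric.infDist_le_dist_of_mem (hroot b hb)
  have hρ1 : ρ ≤ 1 := hρb.trans (hlt.le.trans (min_le_left _ _))
  have hρδ : L * ρ ≤ δ / 2 := by
    have : ρ ≤ δ / (2 * L) := hρb.trans (hlt.le.trans (min_le_right _ _))
    rw [le_div_iff₀ (by positivity)] at this
    linarith
  have hρpos : 0 < ρ := by
    rw [hcd, dist_pos]
    rintro rfl
    exact hc hx
  have hsub : Metric.ball x ρ ⊆ Ω := by
    intro y hy
    by_contra hyΩ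
    have h1 : ρ ≤ dist x y := Metric.infDist_le_dist_of_mem hyΩ
    rw [Metric.mem_ball, dist_comm] at hy
    exact absurd hy (not_lt.2 h1)
  have hrL : ∀ y ∈ Metric.ball x ρ, ‖r y‖ ≤ L := by
    intro y hy
    have h1 : ‖y‖ ≤ R + 2 := by
      have e1 : dist y b ≤ dist y x + dist x b := dist_triangle _ _ _
      have e2 : ‖y‖ ≤ ‖b‖ + dist y b := by
        rw [dist_eq_norm]
        have := norm_add_le b (y - b)
        rwa [add_sub_cancel] at this
      have e3 := hR b hb
      have e4 := Metric.mem_ball.1 hy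
      have e5 := hlt.le.trans (min_le_left _ _)
      linarith
    have h2 := hM y (by simpa using h1)
    rw [← hr.sq y (hsub hy), norm_pow] at h2
    nlinarith [sq_nonneg (‖r y‖ - 1), norm_nonneg (r y), le_abs_self M]
  have hK : IsCompact (ψ '' Metric.closedBall (S x) (δ / 2)) ∧
      ψ '' Metric.closedBall (S x) (δ / 2) ⊆ Ω := by
    have h1 : Metric.closedBall (S x) (δ / 2) ⊆ strip (mu Ω S) :=
      (closedBall_subset_substrip hxδ).trans (substrip_subset_strip (by linarith))
    refine ⟨(isCompact_closedBall _ _).image_of_continuousOn fun w hw =>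
      (h.hasDerivAt w (h1 hw)).continuousAt.continuousWithinAt, ?_⟩
    rintro _ ⟨w, hw, rfl⟩
    exact h.mem w (h1 hw)
  have hballK : Metric.ball x ρ ⊆ ψ '' Metric.closedBall (S x) (δ / 2) := by
    intro y hy
    refine ⟨S y, ?_, h.left_inv y (hsub hy)⟩
    have h1 := (convex_ball x ρ).norm_image_sub_le_of_norm_hasDerivWithin_le (f := S) (f' := r)
      (fun u hu => (h.deriv u (hsub hu)).hasDerivWithinAt) hrL (Metric.mem_ball_self hρpos) hy
    rw [Metric.mem_closedBall, dist_eq_norm]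
    refine h1.trans (le_trans ?_ hρδ)
    rw [← dist_eq_norm]
    exact mul_le_mul_of_nonneg_left (Metric.mem_ball.1 hy).le hLpos.le
  have hcK : c ∈ ψ '' Metric.closedBall (S x) (δ / 2) := by
    have h1 := closure_minimal hballK hK.1.isClosed
    rw [closure_ball x hρpos.ne'] at h1
    exact h1 (by rw [Metric.mem_closedBall, dist_comm]; exact hcd.symm.le)
  exact hc (hK.2 hcK)

/-- Factor by factor: `1 + |x| ≤ |x - b| + (1 + |b|)`, and the last term is at most `(1 + |b|) / ε`
times `|x - b|`. -/
theorem exists_one_add_norm_pow_le_prod (m : Multiset ℂ) {ε : ℝ} (hε : 0 < ε) :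
    ∃ K, 0 ≤ K ∧ ∀ x : ℂ, (∀ b ∈ m, ε ≤ dist x b) →
      (1 + ‖x‖) ^ m.card ≤ K * ‖(m.map (x - ·)).prod‖ := by
  induction m using Multiset.induction with
  | empty => exact ⟨1, zero_le_one, fun x _ => by simp⟩
  | cons b m ih =>
    obtain ⟨K, hK0, hK⟩ := ih
    refine ⟨K * (1 + (1 + ‖b‖) / ε), by positivity, fun x hx => ?_⟩
    have h1 := hK x fun c hc => hx c (Multiset.mem_cons_of_mem hc)
    have h2 : ε ≤ ‖x - b‖ := by rw [← dist_eq_norm]; exact hx b (Multiset.mem_cons_self b m)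
    have h3 : 1 + ‖x‖ ≤ (1 + (1 + ‖b‖) / ε) * ‖x - b‖ := by
      have e1 : ‖x‖ ≤ ‖x - b‖ + ‖b‖ := by simpa using norm_add_le (x - b) b
      have e2 : 1 + ‖b‖ ≤ (1 + ‖b‖) / ε * ‖x - b‖ := by
        rw [div_mul_eq_mul_div, le_div_iff₀ hε]
        gcongr
      linarith
    rw [Multiset.card_cons, pow_succ, Multiset.map_cons, Multiset.prod_cons, norm_mul]
    calc (1 + ‖x‖) ^ m.card * (1 + ‖x‖)
        ≤ (K * ‖(m.map (x - ·)).prod‖) * ((1 + (1 + ‖b‖) / ε) * ‖x - b‖) := by gcongr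
      _ = _ := by ring

theorem exists_norm_eval_le_one_add_norm_pow (P : Polynomial ℂ) {n : ℕ} (hn : P.natDegree ≤ n) :
    ∃ K, 0 ≤ K ∧ ∀ x : ℂ, ‖P.eval x‖ ≤ K * (1 + ‖x‖) ^ n := by
  refine ⟨∑ i ∈ Finset.range (P.natDegree + 1), ‖P.coeff i‖,
    Finset.sum_nonneg fun i _ => norm_nonneg _, fun x => ?_⟩
  rw [Polynomial.eval_eq_sum_range, Finset.sum_mul]
  refine (norm_sum_le _ _).trans (Finset.sum_le_sum fun i hi => ?_)
  rw [norm_mul, norm_pow]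
  have h1 : ‖x‖ ^ i ≤ (1 + ‖x‖) ^ i := by gcongr; linarith
  have h2 : (1 + ‖x‖) ^ i ≤ (1 + ‖x‖) ^ n :=
    pow_le_pow_right₀ (by linarith [norm_nonneg x]) (by
      have := Finset.mem_range.1 hi
      omega)
  exact mul_le_mul_of_nonneg_left (h1.trans h2) (norm_nonneg _)

/-- Away from its zeros a polynomial dominates all polynomials of at most the same degree. -/
theorem exists_norm_eval_div_le {P R : Polynomial ℂ} (hR : R ≠ 0)
    (hdeg : P.natDegree ≤ R.natDegree) {ε : ℝ} (hε : 0 < ε) :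
    ∃ K, ∀ x : ℂ, (∀ b, R.IsRoot b → ε ≤ dist x b) → ‖P.eval x / R.eval x‖ ≤ K := by
  obtain ⟨K₁, hK₁, h₁⟩ := exists_norm_eval_le_one_add_norm_pow P hdeg
  obtain ⟨K₂, hK₂, h₂⟩ := exists_one_add_norm_pow_le_prod R.roots hε
  have hlc : 0 < ‖R.leadingCoeff‖ := norm_pos_iff.2 (Polynomial.leadingCoeff_ne_zero.2 hR)
  refine ⟨K₁ * (K₂ / ‖R.leadingCoeff‖), fun x hx => ?_⟩
  have hRx : R.eval x ≠ 0 := by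
    intro h0
    have := hx x h0
    rw [dist_self] at this
    exact absurd hε (not_lt.2 this)
  have h3 := h₂ x fun b hb => hx b (Polynomial.isRoot_of_mem_roots hb)
  have hs := IsAlgClosed.splits R
  rw [← hs.natDegree_eq_card_roots] at h3
  have h4 : ‖R.eval x‖ = ‖R.leadingCoeff‖ * ‖(R.roots.map (x - ·)).prod‖ := by
    rw [hs.eval_eq_prod_roots, norm_mul]
  rw [norm_div, div_le_iff₀ (norm_pos_iff.2 hRx)]
  calc ‖P.eval x‖ ≤ K₁ * (K₂ * ‖(R.roots.map (x - ·)).prod‖) :=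
        (h₁ x).trans (mul_le_mul_of_nonneg_left h3 hK₁)
    _ = _ := by rw [h4]; field_simp

section Potential

variable {Q : Polynomial ℂ}

/-- The numerator of `C / Q` as a rational function. -/
def potNumerator (Q : Polynomial ℂ) : Polynomial ℂ :=
  4 * (Q.derivative.derivative * Q) - 5 * Q.derivative ^ 2

theorem potC_eq {x : ℂ} (hx : Q.eval x ≠ 0) :
    potC Q x = (potNumerator Q).eval x / (16 * Q.eval x ^ 2) := by
  have h1 : HasDerivAt (s1 Q)
      ((-(Q.derivative.derivative.eval x) * (4 * Q.eval x) -
        -(Q.derivative.eval x) * (4 * Q.derivative.eval x)) / (4 * Q.eval x) ^ 2) x :=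
    (Q.derivative.hasDerivAt x).neg.div ((Q.hasDerivAt x).const_mul 4)
      (mul_ne_zero (by norm_num) hx)
  rw [potC, h1.deriv, s1, potNumerator]
  simp only [Polynomial.eval_sub, Polynomial.eval_mul, Polynomial.eval_pow, Polynomial.eval_ofNat]
  field_simp
  ring

theorem potC_div_eq {x : ℂ} (hx : Q.eval x ≠ 0) :
    potC Q x / Q.eval x = (potNumerator Q).eval x / (16 * Q ^ 3 : Polynomial ℂ).eval x := by
  rw [potC_eq hx]
  simp only [Polynomial.eval_mul, Polynomial.eval_pow, Polynomial.eval_ofNat]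
  field_simp

/-- The numerator has degree at most `2 deg Q`, against `3 deg Q` in the denominator. -/
theorem natDegree_potNumerator_le :
    (potNumerator Q).natDegree ≤ (16 * Q ^ 3 : Polynomial ℂ).natDegree := by
  have h0 : (16 * Q ^ 3 : Polynomial ℂ).natDegree = 3 * Q.natDegree := by
    have : (16 : Polynomial ℂ) = Polynomial.C 16 := rfl
    rw [this, Polynomial.natDegree_C_mul (by norm_num), Polynomial.natDegree_pow]
  have h1 := Q.natDegree_derivative_le
  have h2 := Q.derivative.natDegree_derivative_le
  rw [h0]
  refine (Polynomial.natDegree_sub_le _ _).trans (max_le ?_ ?_)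
  · have : (4 : Polynomial ℂ) = Polynomial.C 4 := rfl
    rw [this]
    refine (Polynomial.natDegree_C_mul_le _ _).trans (Polynomial.natDegree_mul_le.trans ?_)
    omega
  · have : (5 : Polynomial ℂ) = Polynomial.C 5 := rfl
    rw [this]
    refine (Polynomial.natDegree_C_mul_le _ _).trans (Polynomial.natDegree_pow_le.trans ?_)
    omega

end Potential

/-- `C / Q` in the coordinate `w = S(x)`. -/
def stripPot (Q : Polynomial ℂ) (ψ : ℂ → ℂ) (w : ℂ) : ℂ := potC Q (ψ w) / Q.eval (ψ w)

section

variable {Q : Polynomial ℂ} {Ω : Set ℂ} {r S ψ : ℂ → ℂ}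

theorem IsGlobalInverse.differentiableOn_stripPot (h : IsGlobalInverse Ω r S ψ)
    (hQ : ∀ x ∈ Ω, Q.eval x ≠ 0) : DifferentiableOn ℂ (stripPot Q ψ) (strip (mu Ω S)) := by
  have h1 : DifferentiableOn ℂ (fun w => (potNumerator Q).eval (ψ w) /
      (16 * Q ^ 3 : Polynomial ℂ).eval (ψ w)) (strip (mu Ω S)) := by
    intro w hw
    have hψ := (h.hasDerivAt w hw).differentiableAt
    have hne : (16 * Q ^ 3 : Polynomial ℂ).eval (ψ w) ≠ 0 := by
      simp only [Polynomial.eval_mul, Polynomial.eval_pow, Polynomial.eval_ofNat]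
      exact mul_ne_zero (by norm_num) (pow_ne_zero _ (hQ _ (h.mem w hw)))
    exact (((potNumerator Q).differentiable.differentiableAt.comp w hψ).div
      ((16 * Q ^ 3 : Polynomial ℂ).differentiable.differentiableAt.comp w hψ)
        hne).differentiableWithinAt
  exact h1.congr fun w hw => potC_div_eq (hQ _ (h.mem w hw))

theorem IsGlobalInverse.exists_norm_stripPot_le (h : IsGlobalInverse Ω r S ψ)
    (hr : IsSqrtBranch Q Ω r) (hQ : ∀ x ∈ Ω, Q.eval x ≠ 0) (hQ0 : Q ≠ 0) {δ : ℝ} (hδ : 0 < δ) :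
    ∃ M, ∀ w ∈ substrip (mu Ω S) δ, ‖stripPot Q ψ w‖ ≤ M := by
  obtain ⟨ε, hε, hdist⟩ := h.exists_le_dist_root hr hQ0 (fun b hb hbΩ => hQ b hbΩ hb) hδ
  have hne : (16 * Q ^ 3 : Polynomial ℂ) ≠ 0 := mul_ne_zero (by norm_num) (pow_ne_zero _ hQ0)
  obtain ⟨K, hK⟩ := exists_norm_eval_div_le hne (natDegree_potNumerator_le (Q := Q)) hε
  refine ⟨K, fun w hw => ?_⟩
  have hws := substrip_subset_strip hδ.le hw
  rw [stripPot, potC_div_eq (hQ _ (h.mem w hws))]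
  refine hK _ fun b hb => hdist _ (h.mem w hws) (by rwa [h.right_inv w hws]) b ?_
  have hb' : (16 * Q ^ 3 : Polynomial ℂ).eval b = 0 := hb
  simpa using hb'

end

/-! ### The integral operator on the strip -/

/-- The integral operator `f ↦ ∫_{-∞}^0 exp(2t/h) f(w + t) dt`. -/
def lap (h : ℝ) (f : ℂ → ℂ) (w : ℂ) : ℂ :=
  ∫ t in Iic (0 : ℝ), (Real.exp (2 * t / h) : ℂ) * f (w + t)

theorem integrableOn_exp_two_mul_div {h : ℝ} (hh : 0 < h) :
    IntegrableOn (fun t : ℝ => Real.exp (2 * t / h)) (Iic 0) := by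
  have := integrableOn_exp_mul_Iic (a := 2 / h) (by positivity) 0
  simpa only [div_mul_eq_mul_div] using this

theorem integral_exp_two_mul_div {h : ℝ} (hh : 0 < h) :
    ∫ t in Iic (0 : ℝ), Real.exp (2 * t / h) = h / 2 := by
  have := integral_exp_mul_Iic (a := 2 / h) (by positivity) 0
  rw [mul_zero, Real.exp_zero, one_div_div] at this
  simpa only [div_mul_eq_mul_div] using this

section Bounds

variable {μ : EReal} {δ h M : ℝ} {f : ℂ → ℂ} {w : ℂ}

theorem norm_exp_mul_le (hM : ∀ u ∈ substrip μ δ, ‖f u‖ ≤ M) (hw : w ∈ substrip μ δ) (t : ℝ) :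
    ‖(Real.exp (2 * t / h) : ℂ) * f (w + t)‖ ≤ M * Real.exp (2 * t / h) := by
  rw [norm_mul, Complex.norm_real, Real.norm_of_nonneg (Real.exp_pos _).le, mul_comm]
  exact mul_le_mul_of_nonneg_right (hM _ (add_mem_substrip hw t)) (Real.exp_pos _).le

theorem continuous_exp_mul (hf : ContinuousOn f (substrip μ δ)) (hw : w ∈ substrip μ δ) :
    Continuous fun t : ℝ => (Real.exp (2 * t / h) : ℂ) * f (w + t) := by
  have h1 : Continuous fun t : ℝ => f (w + t) :=
    hf.comp_continuous (by fun_prop) (add_mem_substrip hw)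
  exact (Complex.continuous_ofReal.comp
    (Real.continuous_exp.comp ((continuous_const.mul continuous_id).div_const h))).mul h1

theorem integrableOn_exp_mul (hh : 0 < h) (hf : ContinuousOn f (substrip μ δ))
    (hM : ∀ u ∈ substrip μ δ, ‖f u‖ ≤ M) (hw : w ∈ substrip μ δ) :
    IntegrableOn (fun t : ℝ => (Real.exp (2 * t / h) : ℂ) * f (w + t)) (Iic 0) :=
  ((integrableOn_exp_two_mul_div hh).const_mul M).mono'
    (continuous_exp_mul hf hw).aestronglyMeasurable
    (ae_of_all _ fun t => norm_exp_mul_le hM hw t)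

theorem norm_lap_le (hh : 0 < h) (hM : ∀ u ∈ substrip μ δ, ‖f u‖ ≤ M) (hw : w ∈ substrip μ δ) :
    ‖lap h f w‖ ≤ M * (h / 2) := by
  rw [← integral_exp_two_mul_div hh, ← integral_const_mul]
  exact norm_integral_le_of_norm_le ((integrableOn_exp_two_mul_div hh).const_mul M)
    (ae_of_all _ fun t => norm_exp_mul_le hM hw t)

end Bounds

/-- Holomorphic functions on the strip that are bounded on every smaller strip. -/
structure BddHol (μ : EReal) (f : ℂ → ℂ) : Prop where
  holo : DifferentiableOn ℂ f (strip μ)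
  bdd : ∀ δ > 0, ∃ M, ∀ w ∈ substrip μ δ, ‖f w‖ ≤ M

namespace BddHol

variable {μ : EReal} {f g : ℂ → ℂ}

theorem zero : BddHol μ fun _ => 0 := ⟨differentiableOn_const _, fun _ _ => ⟨0, by simp⟩⟩

theorem add (hf : BddHol μ f) (hg : BddHol μ g) : BddHol μ fun w => f w + g w := by
  refine ⟨hf.holo.add hg.holo, fun δ hδ => ?_⟩
  obtain ⟨M, hM⟩ := hf.bdd δ hδ
  obtain ⟨M', hM'⟩ := hg.bdd δ hδ
  exact ⟨M + M', fun w hw => (norm_add_le _ _).trans (add_le_add (hM w hw) (hM' w hw))⟩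

theorem mul (hf : BddHol μ f) (hg : BddHol μ g) : BddHol μ fun w => f w * g w := by
  refine ⟨hf.holo.mul hg.holo, fun δ hδ => ?_⟩
  obtain ⟨M, hM⟩ := hf.bdd δ hδ
  obtain ⟨M', hM'⟩ := hg.bdd δ hδ
  refine ⟨M * M', fun w hw => ?_⟩
  rw [norm_mul]
  exact mul_le_mul (hM w hw) (hM' w hw) (norm_nonneg _) ((norm_nonneg _).trans (hM w hw))

theorem const_mul (c : ℂ) (hf : BddHol μ f) : BddHol μ fun w => c * f w :=
  mul ⟨differentiableOn_const _, fun _ _ => ⟨‖c‖, by simp⟩⟩ hf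

theorem neg (hf : BddHol μ f) : BddHol μ fun w => -f w := by
  simpa using hf.const_mul (-1)

theorem sum {ι : Type*} (s : Finset ι) {F : ι → ℂ → ℂ} (hF : ∀ i ∈ s, BddHol μ (F i)) :
    BddHol μ fun w => ∑ i ∈ s, F i w := by
  classical
  induction s using Finset.induction_on with
  | empty => simpa using zero
  | insert i s hi ih =>
    simp only [Finset.sum_insert hi]
    exact (hF i (Finset.mem_insert_self i s)).add
      (ih fun j hj => hF j (Finset.mem_insert_of_mem hj))

theorem continuousOn (hf : BddHol μ f) {δ : ℝ} (hδ : 0 ≤ δ) : ContinuousOn f (substrip μ δ) :=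
  hf.holo.continuousOn.mono (substrip_subset_strip hδ)

theorem integrableOn (hf : BddHol μ f) {h : ℝ} (hh : 0 < h) {w : ℂ} (hw : w ∈ strip μ) :
    IntegrableOn (fun t : ℝ => (Real.exp (2 * t / h) : ℂ) * f (w + t)) (Iic 0) := by
  obtain ⟨δ, hδ, hwδ⟩ := exists_mem_substrip hw
  obtain ⟨M, hM⟩ := hf.bdd δ hδ
  exact integrableOn_exp_mul hh (hf.continuousOn hδ.le) hM hwδ

/-- Cauchy's estimate on discs of radius `δ / 2`. It costs half of `δ`, which is why the class asks
for a bound on every smaller strip. -/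
theorem deriv (hf : BddHol μ f) : BddHol μ (deriv f) := by
  refine ⟨hf.holo.deriv (isOpen_strip μ), fun δ hδ => ?_⟩
  obtain ⟨M, hM⟩ := hf.bdd (δ / 2) (by positivity)
  refine ⟨M / (δ / 2), fun w hw => ?_⟩
  have hsub : Metric.closedBall w (δ / 2) ⊆ substrip μ (δ / 2) := by
    have := closedBall_subset_substrip (η := δ / 2) hw
    rwa [sub_half] at this
  refine Complex.norm_deriv_le_of_forall_mem_sphere_norm_le (by positivity) ?_
    fun z hz => hM z (hsub (Metric.sphere_subset_closedBall hz))
  refine (hf.holo.mono ?_).diffContOnCl_ball subset_rfl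
  exact hsub.trans (substrip_subset_strip (by positivity))

theorem hasDerivAt_lap (hf : BddHol μ f) {h : ℝ} (hh : 0 < h) {w : ℂ} (hw : w ∈ strip μ) :
    HasDerivAt (lap h f) (lap h (_root_.deriv f) w) w := by
  obtain ⟨δ, hδ, hwδ⟩ := exists_mem_substrip hw
  obtain ⟨M, hM⟩ := hf.deriv.bdd δ hδ
  have hnhds : substrip μ δ ∈ 𝓝 w := (isOpen_substrip μ δ).mem_nhds hwδ
  refine (hasDerivAt_integral_of_dominated_loc_of_deriv_le
    (F := fun (w : ℂ) (t : ℝ) => (Real.exp (2 * t / h) : ℂ) * f (w + t))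
    (F' := fun (w : ℂ) (t : ℝ) => (Real.exp (2 * t / h) : ℂ) * _root_.deriv f (w + t))
    (bound := fun t => M * Real.exp (2 * t / h)) hnhds ?_ (hf.integrableOn hh hw)
    (hf.deriv.integrableOn hh hw).aestronglyMeasurable ?_
    ((integrableOn_exp_two_mul_div hh).const_mul M) ?_).2
  · filter_upwards [hnhds] with u hu
    exact (continuous_exp_mul (hf.continuousOn hδ.le) hu).aestronglyMeasurable
  · exact ae_of_all _ fun t u hu => norm_exp_mul_le hM hu t
  · refine ae_of_all _ fun t u hu => ?_
    have hm := add_mem_substrip hu t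
    have h1 := (hf.holo.differentiableAt
      ((isOpen_strip μ).mem_nhds (substrip_subset_strip hδ.le hm))).hasDerivAt
    exact (h1.comp_add_const u (t : ℂ)).const_mul _

theorem lap (hf : BddHol μ f) {h : ℝ} (hh : 0 < h) : BddHol μ (lap h f) := by
  refine ⟨fun w hw => (hf.hasDerivAt_lap hh hw).differentiableAt.differentiableWithinAt,
    fun δ hδ => ?_⟩
  obtain ⟨M, hM⟩ := hf.bdd δ hδ
  exact ⟨M * (h / 2), fun w hw => norm_lap_le hh hM hw⟩

theorem lap_add (hf : BddHol μ f) (hg : BddHol μ g) {h : ℝ} (hh : 0 < h) {w : ℂ}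
    (hw : w ∈ strip μ) :
    WKB.lap h (fun w => f w + g w) w = WKB.lap h f w + WKB.lap h g w := by
  rw [WKB.lap, WKB.lap, WKB.lap, ← integral_add (hf.integrableOn hh hw) (hg.integrableOn hh hw)]
  simp only [mul_add]

/-- Integration by parts. -/
theorem lap_eq (hf : BddHol μ f) {h : ℝ} (hh : 0 < h) {w : ℂ} (hw : w ∈ strip μ) :
    WKB.lap h f w = h / 2 * f w - h / 2 * WKB.lap h (_root_.deriv f) w := by
  obtain ⟨δ, hδ, hwδ⟩ := exists_mem_substrip hw
  obtain ⟨M, hM⟩ := hf.bdd δ hδ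
  have hh0 : (h : ℂ) ≠ 0 := by exact_mod_cast hh.ne'
  let E : ℝ → ℂ := fun t => (Real.exp (2 * t / h) : ℂ)
  have hE : ∀ t, HasDerivAt E (E t * (2 / h)) t := by
    intro t
    have h1 : HasDerivAt (fun t : ℝ => 2 * t / h) (2 * 1 / h) t :=
      ((hasDerivAt_id t).const_mul 2).div_const h
    have h2 := h1.exp.ofReal_comp
    rw [mul_one] at h2
    push_cast at h2
    simpa [E] using h2
  have hd : ∀ t : ℝ, HasDerivAt (fun t : ℝ => h / 2 * (E t * f (w + t)))
      (E t * f (w + t) + h / 2 * (E t * _root_.deriv f (w + t))) t := by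
    intro t
    have hm := add_mem_substrip hwδ t
    have h1 := (hf.holo.differentiableAt
      ((isOpen_strip μ).mem_nhds (substrip_subset_strip hδ.le hm))).hasDerivAt
    have h2 : HasDerivAt (fun u : ℝ => w + (u : ℂ)) 1 t :=
      (Complex.ofRealCLM.hasDerivAt (x := t)).const_add _
    have h3 := HasDerivAt.comp t h1 h2
    rw [mul_one] at h3
    have h4 := ((hE t).mul h3).const_mul ((h : ℂ) / 2)
    refine h4.congr_deriv ?_
    simp only [Function.comp_apply]
    field_simp
  have hlim : Tendsto (fun t : ℝ => h / 2 * (E t * f (w + t))) atBot (𝓝 0) := by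
    have h1 : Tendsto (fun t : ℝ => M * Real.exp (2 * t / h)) atBot (𝓝 0) := by
      have h2 : Tendsto (fun t : ℝ => 2 * t / h) atBot atBot :=
        (tendsto_id.const_mul_atBot two_pos).atBot_div_const hh
      simpa using (Real.tendsto_exp_atBot.comp h2).const_mul M
    have h2 : Tendsto (fun t : ℝ => E t * f (w + t)) atBot (𝓝 0) :=
      squeeze_zero_norm (fun t => norm_exp_mul_le hM hwδ t) h1
    simpa using h2.const_mul ((h : ℂ) / 2)
  have hi1 := hf.integrableOn hh hw
  have hi2 := (hf.deriv.integrableOn hh hw).const_mul ((h : ℂ) / 2)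
  have key := integral_Iic_of_hasDerivAt_of_tendsto (a := 0)
    (hd 0).continuousAt.continuousWithinAt (fun t _ => hd t) (hi1.add hi2) hlim
  have h5 : WKB.lap h f w + h / 2 * WKB.lap h (_root_.deriv f) w = h / 2 * f w := by
    rw [WKB.lap, WKB.lap, ← integral_const_mul, ← integral_add hi1 hi2]
    simpa [E] using key
  linear_combination h5

end BddHol

theorem lap_const_mul (h : ℝ) (c : ℂ) (f : ℂ → ℂ) (w : ℂ) :
    lap h (fun u => c * f u) w = c * lap h f w := by
  rw [lap, lap, ← integral_const_mul]
  congr 1; funext t; ring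

/-! ### Calculus of asymptotic expansions in `h` -/

/-- `f(w, h) ∼ ∑ b_k(w) h^k`, uniformly for `w ∈ A` and `0 < h < H`. -/
def AsympOn (A : Set ℂ) (H : ℝ) (f : ℝ → ℂ → ℂ) (b : ℕ → ℂ → ℂ) : Prop :=
  ∀ N : ℕ, ∃ C : ℝ, ∀ h ∈ Ioo 0 H, ∀ w ∈ A,
    ‖f h w - ∑ k ∈ Finset.range N, b k w * (h : ℂ) ^ k‖ ≤ C * h ^ N

/-- The coefficients of a product of expansions. -/
def conv (b c : ℕ → ℂ → ℂ) (k : ℕ) (w : ℂ) : ℂ :=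
  ∑ p ∈ Finset.HasAntidiagonal.antidiagonal k, b p.1 w * c p.2 w

/-- The coefficients of the expansion of `lap h f`. -/
def lapCoeff₀ : ℕ → (ℂ → ℂ) → ℂ → ℂ
  | 0, _ => fun _ => 0
  | 1, f => fun w => f w / 2
  | k + 2, f => fun w => -(lapCoeff₀ (k + 1) (deriv f) w / 2)

/-- The coefficients of the expansion of `lap h f` when `f` has an expansion itself. -/
def lapCoeff (b : ℕ → ℂ → ℂ) (k : ℕ) (w : ℂ) : ℂ :=
  ∑ p ∈ Finset.HasAntidiagonal.antidiagonal k, lapCoeff₀ p.2 (b p.1) w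

theorem conv_succ (b c : ℕ → ℂ → ℂ) (k : ℕ) (w : ℂ) :
    conv b c (k + 1) w = b 0 w * c (k + 1) w + conv (fun j => b (j + 1)) c k w := by
  simp only [conv, Finset.Nat.sum_antidiagonal_succ]

theorem conv_zero (b c : ℕ → ℂ → ℂ) (w : ℂ) : conv b c 0 w = b 0 w * c 0 w := by
  simp [conv]

theorem lapCoeff_succ (b : ℕ → ℂ → ℂ) (k : ℕ) (w : ℂ) :
    lapCoeff b (k + 1) w = lapCoeff₀ (k + 1) (b 0) w + lapCoeff (fun j => b (j + 1)) k w := by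
  simp only [lapCoeff, Finset.Nat.sum_antidiagonal_succ]

theorem lapCoeff_zero (b : ℕ → ℂ → ℂ) (w : ℂ) : lapCoeff b 0 w = 0 := by
  simp [lapCoeff, lapCoeff₀]

theorem BddHol.lapCoeff₀ {μ : EReal} (k : ℕ) : ∀ {f : ℂ → ℂ}, BddHol μ f →
    BddHol μ (lapCoeff₀ k f) := by
  induction k with
  | zero => exact fun _ => BddHol.zero
  | succ k ih =>
    intro f hf
    cases k with
    | zero =>
      have := hf.const_mul (1 / 2)
      simp only [WKB.lapCoeff₀]
      simpa only [one_div_mul_eq_div] using this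
    | succ k =>
      have := ((ih hf.deriv).const_mul (1 / 2)).neg
      simp only [WKB.lapCoeff₀]
      simpa only [one_div_mul_eq_div] using this

theorem BddHol.conv {μ : EReal} {b c : ℕ → ℂ → ℂ} (hb : ∀ k, BddHol μ (b k))
    (hc : ∀ k, BddHol μ (c k)) (k : ℕ) : BddHol μ (conv b c k) :=
  BddHol.sum _ fun p _ => (hb p.1).mul (hc p.2)

theorem BddHol.lapCoeff {μ : EReal} {b : ℕ → ℂ → ℂ} (hb : ∀ k, BddHol μ (b k)) (k : ℕ) :
    BddHol μ (lapCoeff b k) :=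
  BddHol.sum _ fun p _ => (hb p.1).lapCoeff₀ p.2

namespace AsympOn

variable {A : Set ℂ} {H : ℝ} {f g : ℝ → ℂ → ℂ} {b c : ℕ → ℂ → ℂ}

theorem bdd (hf : AsympOn A H f b) : ∃ C, 0 ≤ C ∧ ∀ h ∈ Ioo 0 H, ∀ w ∈ A, ‖f h w‖ ≤ C := by
  obtain ⟨C, hC⟩ := hf 0
  refine ⟨|C|, abs_nonneg C, fun h hh w hw => ?_⟩
  have := hC h hh w hw
  simp only [Finset.range_zero, Finset.sum_empty, sub_zero, pow_zero, mul_one] at this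
  exact this.trans (le_abs_self C)

/-- Dropping the constant term and dividing by `h` peels off one coefficient at a time; the
expansions of products and of `lap` are obtained by induction on `N` with this step. -/
theorem shift (hf : AsympOn A H f b) :
    AsympOn A H (fun h w => (h : ℂ)⁻¹ * (f h w - b 0 w)) (fun k => b (k + 1)) := by
  intro N
  obtain ⟨C, hC⟩ := hf (N + 1)
  refine ⟨C, fun h hh w hw => ?_⟩
  have hh0 : (h : ℂ) ≠ 0 := by exact_mod_cast hh.1.ne'
  have h1 := hC h hh w hw
  rw [Finset.sum_range_succ'] at h1
  have h2 : f h w - (∑ k ∈ Finset.range N, b (k + 1) w * (h : ℂ) ^ (k + 1) + b 0 w * (h : ℂ) ^ 0) =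
      h * ((h : ℂ)⁻¹ * (f h w - b 0 w) - ∑ k ∈ Finset.range N, b (k + 1) w * (h : ℂ) ^ k) := by
    rw [mul_sub, mul_inv_cancel_left₀ hh0, Finset.mul_sum]
    simp only [pow_succ, pow_zero, mul_one]
    rw [sub_sub, add_comm]
    congr 2
    exact Finset.sum_congr rfl fun k _ => by ring
  rw [h2, norm_mul, Complex.norm_real, Real.norm_of_nonneg hh.1.le, pow_succ, ← mul_assoc,
    mul_comm _ h] at h1
  exact le_of_mul_le_mul_left h1 hh.1

theorem add (hf : AsympOn A H f b) (hg : AsympOn A H g c) :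
    AsympOn A H (fun h w => f h w + g h w) (fun k w => b k w + c k w) := by
  intro N
  obtain ⟨C, hC⟩ := hf N
  obtain ⟨C', hC'⟩ := hg N
  refine ⟨C + C', fun h hh w hw => ?_⟩
  have h1 := (norm_add_le _ _).trans (add_le_add (hC h hh w hw) (hC' h hh w hw))
  rw [← add_mul] at h1
  refine le_of_eq_of_le (congrArg _ ?_) h1
  simp only [add_mul, Finset.sum_add_distrib]
  ring

theorem neg (hf : AsympOn A H f b) :
    AsympOn A H (fun h w => -f h w) (fun k w => -b k w) := by
  intro N
  obtain ⟨C, hC⟩ := hf N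
  refine ⟨C, fun h hh w hw => ?_⟩
  have h1 := hC h hh w hw
  rw [← norm_neg] at h1
  refine le_of_eq_of_le (congrArg _ ?_) h1
  simp only [neg_mul, Finset.sum_neg_distrib]
  ring

theorem zero : AsympOn A H (fun _ _ => 0) (fun _ _ => 0) := fun N => ⟨0, fun h _ w _ => by simp⟩

theorem sum {ι : Type*} (s : Finset ι) {F : ι → ℝ → ℂ → ℂ} {B : ι → ℕ → ℂ → ℂ}
    (hF : ∀ i ∈ s, AsympOn A H (F i) (B i)) :
    AsympOn A H (fun h w => ∑ i ∈ s, F i h w) (fun k w => ∑ i ∈ s, B i k w) := by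
  classical
  induction s using Finset.induction_on with
  | empty => simpa using zero
  | insert i s hi ih =>
    simp only [Finset.sum_insert hi]
    exact (hF i (Finset.mem_insert_self i s)).add
      (ih fun j hj => hF j (Finset.mem_insert_of_mem hj))

/-- With `f₁` the shift of `f`, `f g = b₀ g + h f₁ g`. The factor `h` supplies the order that the
induction hypothesis for `f₁ g` lacks. -/
theorem mul (hf : AsympOn A H f b) (hg : AsympOn A H g c)
    (hb : ∀ k, ∃ M, ∀ w ∈ A, ‖b k w‖ ≤ M) :
    AsympOn A H (fun h w => f h w * g h w) (conv b c) := by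
  intro N
  induction N generalizing f b with
  | zero =>
    obtain ⟨C, hC0, hC⟩ := hf.bdd
    obtain ⟨C', -, hC'⟩ := hg.bdd
    refine ⟨C * C', fun h hh w hw => ?_⟩
    simp only [Finset.range_zero, Finset.sum_empty, sub_zero, pow_zero, mul_one, norm_mul]
    exact mul_le_mul (hC h hh w hw) (hC' h hh w hw) (norm_nonneg _) hC0
  | succ N ih =>
    obtain ⟨C₁, h₁⟩ := ih hf.shift fun k => hb (k + 1)
    obtain ⟨C₂, h₂⟩ := hg (N + 1)
    obtain ⟨M, hM⟩ := hb 0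
    refine ⟨M * C₂ + C₁, fun h hh w hw => ?_⟩
    have hh0 : (h : ℂ) ≠ 0 := by exact_mod_cast hh.1.ne'
    have e : f h w * g h w - ∑ k ∈ Finset.range (N + 1), conv b c k w * (h : ℂ) ^ k =
        b 0 w * (g h w - ∑ k ∈ Finset.range (N + 1), c k w * (h : ℂ) ^ k) +
        h * ((h : ℂ)⁻¹ * (f h w - b 0 w) * g h w -
          ∑ k ∈ Finset.range N, conv (fun j => b (j + 1)) c k w * (h : ℂ) ^ k) := by
      rw [Finset.sum_range_succ', Finset.sum_range_succ' (fun k => c k w * (h : ℂ) ^ k)]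
      simp only [conv_succ, conv_zero, mul_sub, mul_add, add_mul, Finset.sum_add_distrib,
        Finset.mul_sum]
      have e1 : ∀ k, (h : ℂ) * (conv (fun j => b (j + 1)) c k w * (h : ℂ) ^ k) =
          conv (fun j => b (j + 1)) c k w * (h : ℂ) ^ (k + 1) := fun k => by ring
      simp only [e1, mul_assoc]
      field_simp
      ring
    rw [e]
    refine (norm_add_le _ _).trans ?_
    rw [norm_mul, norm_mul, Complex.norm_real, Real.norm_of_nonneg hh.1.le, add_mul]
    refine add_le_add ?_ ?_
    · rw [mul_assoc]
      exact mul_le_mul (hM w hw) (h₂ h hh w hw) (norm_nonneg _)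
        ((norm_nonneg _).trans (hM w hw))
    · have := mul_le_mul_of_nonneg_left (h₁ h hh w hw) hh.1.le
      rw [pow_succ]
      linarith

end AsympOn

section Lap

variable {μ : EReal} {δ H : ℝ}

/-- Repeated integration by parts: each one yields a coefficient and leaves `lap` of a derivative
with an extra factor `-h / 2`. -/
theorem BddHol.asympOn_lap (hδ : 0 < δ) {f : ℂ → ℂ} (hf : BddHol μ f) :
    AsympOn (substrip μ δ) H (fun h => WKB.lap h f) (fun k => WKB.lapCoeff₀ k f) := by
  intro N
  induction N generalizing f with
  | zero =>
    obtain ⟨M, hM⟩ := hf.bdd δ hδ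
    refine ⟨|M| * (H / 2), fun h hh w hw => ?_⟩
    simp only [Finset.range_zero, Finset.sum_empty, sub_zero, pow_zero, mul_one]
    refine (norm_lap_le hh.1 (fun u hu => (hM u hu).trans (le_abs_self M)) hw).trans ?_
    have := hh.2
    gcongr
  | succ N ih =>
    cases N with
    | zero =>
      obtain ⟨M, hM⟩ := hf.bdd δ hδ
      refine ⟨M / 2, fun h hh w hw => ?_⟩
      have := norm_lap_le hh.1 hM hw
      simp only [zero_add, Finset.range_one, Finset.sum_singleton, WKB.lapCoeff₀, zero_mul,
        sub_zero, pow_one]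
      linarith
    | succ N =>
      obtain ⟨C, hC⟩ := ih hf.deriv
      refine ⟨C / 2, fun h hh w hw => ?_⟩
      have e : WKB.lap h f w - ∑ k ∈ Finset.range (N + 2), WKB.lapCoeff₀ k f w * (h : ℂ) ^ k =
          -(h / 2) * (WKB.lap h (_root_.deriv f) w -
            ∑ k ∈ Finset.range (N + 1), WKB.lapCoeff₀ k (_root_.deriv f) w * (h : ℂ) ^ k) := by
        rw [hf.lap_eq hh.1 (substrip_subset_strip hδ.le hw), Finset.sum_range_succ',
          Finset.sum_range_succ', Finset.sum_range_succ']
        simp only [WKB.lapCoeff₀, mul_sub, mul_add, Finset.mul_sum]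
        have e1 : ∀ k, -(WKB.lapCoeff₀ (k + 1) (_root_.deriv f) w / 2) * (h : ℂ) ^ (k + 1 + 1) =
            -(h / 2) * (WKB.lapCoeff₀ (k + 1) (_root_.deriv f) w * (h : ℂ) ^ (k + 1)) :=
          fun k => by ring
        simp only [e1]
        ring
      rw [e, norm_mul, norm_neg, norm_div, Complex.norm_real, Real.norm_of_nonneg hh.1.le]
      have h2 : ‖(2 : ℂ)‖ = 2 := by simp
      rw [h2]
      have := mul_le_mul_of_nonneg_left (hC h hh w hw) (half_pos hh.1).le
      rw [pow_succ]
      linarith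

/-- By linearity `lap f = lap b₀ + h lap f₁` with `f₁` the shift of `f`; the first summand has
`h`-independent input, the second goes by induction. -/
theorem AsympOn.lap (hδ : 0 < δ) {f : ℝ → ℂ → ℂ} {b : ℕ → ℂ → ℂ}
    (hf : ∀ h, 0 < h → BddHol μ (f h)) (hb : ∀ k, BddHol μ (b k))
    (ha : AsympOn (substrip μ δ) H f b) :
    AsympOn (substrip μ δ) H (fun h => WKB.lap h (f h)) (lapCoeff b) := by
  intro N
  induction N generalizing f b with
  | zero =>
    obtain ⟨C, hC0, hC⟩ := ha.bdd
    refine ⟨C * (H / 2), fun h hh w hw => ?_⟩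
    simp only [Finset.range_zero, Finset.sum_empty, sub_zero, pow_zero, mul_one]
    refine (norm_lap_le hh.1 (hC h hh) hw).trans ?_
    have := hh.2
    gcongr
  | succ N ih =>
    have hf' : ∀ h : ℝ, 0 < h → BddHol μ fun w => (h : ℂ)⁻¹ * (f h w - b 0 w) := fun h hh => by
      simpa only [sub_eq_add_neg] using ((hf h hh).add (hb 0).neg).const_mul _
    obtain ⟨C₁, h₁⟩ := ih hf' (fun k => hb (k + 1)) ha.shift
    obtain ⟨C₂, h₂⟩ := (hb 0).asympOn_lap (H := H) hδ (N + 1)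
    refine ⟨C₂ + C₁, fun h hh w hw => ?_⟩
    have hh0 : (h : ℂ) ≠ 0 := by exact_mod_cast hh.1.ne'
    have hws := substrip_subset_strip hδ.le hw
    have e0 : WKB.lap h (f h) w =
        WKB.lap h (b 0) w + h * WKB.lap h (fun u => (h : ℂ)⁻¹ * (f h u - b 0 u)) w := by
      rw [← lap_const_mul, ← (hb 0).lap_add ((hf' h hh.1).const_mul _) hh.1 hws]
      congr 1
      funext u
      rw [mul_inv_cancel_left₀ hh0]
      ring
    have e : WKB.lap h (f h) w - ∑ k ∈ Finset.range (N + 1), lapCoeff b k w * (h : ℂ) ^ k =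
        (WKB.lap h (b 0) w - ∑ k ∈ Finset.range (N + 1), lapCoeff₀ k (b 0) w * (h : ℂ) ^ k) +
        h * (WKB.lap h (fun u => (h : ℂ)⁻¹ * (f h u - b 0 u)) w -
          ∑ k ∈ Finset.range N, lapCoeff (fun j => b (j + 1)) k w * (h : ℂ) ^ k) := by
      rw [e0, Finset.sum_range_succ',
        Finset.sum_range_succ' (fun k => lapCoeff₀ k (b 0) w * (h : ℂ) ^ k)]
      simp only [lapCoeff_succ, lapCoeff_zero, lapCoeff₀, mul_sub, add_mul, zero_mul, add_zero,
        Finset.sum_add_distrib, Finset.mul_sum]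
      have e1 : ∀ k, (h : ℂ) * (lapCoeff (fun j => b (j + 1)) k w * (h : ℂ) ^ k) =
          lapCoeff (fun j => b (j + 1)) k w * (h : ℂ) ^ (k + 1) := fun k => by ring
      simp only [e1]
      ring
    rw [e]
    refine (norm_add_le _ _).trans ?_
    rw [norm_mul, Complex.norm_real, Real.norm_of_nonneg hh.1.le, add_mul]
    refine add_le_add (h₂ h hh w hw) ?_
    have := mul_le_mul_of_nonneg_left (h₁ h hh w hw) hh.1.le
    rw [pow_succ]
    linarith

end Lap

/-! ### The terms of the series: order in `h` and size (index `n` stands for `g_{n+1}`) -/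

/-- The terms of the series for `g` in the coordinate of the strip. -/
def stripTerm (F : ℂ → ℂ) (h : ℝ) : ℕ → ℂ → ℂ
  | 0 => lap h F
  | n + 1 => fun w => -∑ i : Fin (n + 1),
      lap h (fun u => stripTerm F h i u * stripTerm F h (n - i) u) w

/-- The coefficients of the expansions of `stripTerm F h n`. -/
def stripCoeff (F : ℂ → ℂ) : ℕ → ℕ → ℂ → ℂ
  | 0 => fun k => lapCoeff₀ k F
  | n + 1 => fun k w => -∑ i : Fin (n + 1),
      lapCoeff (conv (stripCoeff F i) (stripCoeff F (n - i))) k w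

section Terms

variable {μ : EReal} {F : ℂ → ℂ}

theorem BddHol.stripTerm (hF : BddHol μ F) {h : ℝ} (hh : 0 < h) (n : ℕ) :
    BddHol μ (stripTerm F h n) := by
  induction n using Nat.strong_induction_on with
  | _ n ih =>
    cases n with
    | zero => rw [WKB.stripTerm]; exact hF.lap hh
    | succ n =>
      rw [WKB.stripTerm]
      exact (BddHol.sum _ fun (i : Fin (n + 1)) _ => ((ih i i.2).mul (ih (n - i) (by omega))).lap hh).neg

theorem BddHol.stripCoeff (hF : BddHol μ F) (n : ℕ) : ∀ k, BddHol μ (stripCoeff F n k) := by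
  induction n using Nat.strong_induction_on with
  | _ n ih =>
    intro k
    cases n with
    | zero => rw [WKB.stripCoeff]; exact hF.lapCoeff₀ k
    | succ n =>
      rw [WKB.stripCoeff]
      exact (BddHol.sum _ fun (i : Fin (n + 1)) _ =>
        BddHol.lapCoeff (BddHol.conv (ih i i.2) (ih (n - i) (by omega))) k).neg

theorem BddHol.asympOn_stripTerm (hF : BddHol μ F) {δ H : ℝ} (hδ : 0 < δ) (n : ℕ) :
    AsympOn (substrip μ δ) H (fun h => WKB.stripTerm F h n) (WKB.stripCoeff F n) := by
  induction n using Nat.strong_induction_on with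
  | _ n ih =>
    cases n with
    | zero => simpa only [WKB.stripTerm, WKB.stripCoeff] using hF.asympOn_lap hδ
    | succ n =>
      simp only [WKB.stripTerm]
      rw [WKB.stripCoeff]
      refine AsympOn.neg (AsympOn.sum Finset.univ fun i _ => AsympOn.lap hδ ?_ ?_ ?_)
      · exact fun h hh => (hF.stripTerm hh i).mul (hF.stripTerm hh (n - i))
      · exact BddHol.conv (hF.stripCoeff i) (hF.stripCoeff (n - i))
      · exact (ih i (by omega)).mul (ih (n - i) (by omega)) fun k => (hF.stripCoeff i k).bdd δ hδ

theorem lapCoeff₀_zero_fun (k : ℕ) : lapCoeff₀ k (fun _ => 0) = fun _ => 0 := by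
  induction k with
  | zero => rfl
  | succ k ih =>
    cases k with
    | zero => simp [lapCoeff₀]
    | succ k =>
      have : deriv (fun _ : ℂ => (0 : ℂ)) = fun _ => 0 := by funext; simp
      simp only [lapCoeff₀, this]
      funext w
      rw [ih]; simp

/-- The orders `2 i + 1` and `2 (n - i) + 1` of two factors add up to `2 n + 2`, and `lap` raises
the order by one. -/
theorem stripCoeff_eq_zero (F : ℂ → ℂ) (n : ℕ) :
    ∀ k < 2 * n + 1, stripCoeff F n k = fun _ => 0 := by
  induction n using Nat.strong_induction_on with
  | _ n ih =>
    intro k hk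
    cases n with
    | zero =>
      obtain rfl : k = 0 := by omega
      rw [stripCoeff]; rfl
    | succ n =>
      have hconv : ∀ i : Fin (n + 1), ∀ j < 2 * n + 2,
          conv (stripCoeff F i) (stripCoeff F (n - i)) j = fun _ => 0 := by
        intro i j hj
        funext w
        refine Finset.sum_eq_zero fun p hp => ?_
        have hp' := Finset.HasAntidiagonal.mem_antidiagonal.1 hp
        have hi := i.2
        rcases lt_or_ge p.1 (2 * i + 1) with h1 | h1
        · rw [ih i (by omega) p.1 h1]; simp
        · rw [ih (n - i) (by omega) p.2 (by omega)]; simp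
      rw [stripCoeff]
      funext w
      rw [neg_eq_zero]
      refine Finset.sum_eq_zero fun i _ => Finset.sum_eq_zero fun p hp => ?_
      have hp' := Finset.HasAntidiagonal.mem_antidiagonal.1 hp
      rcases Nat.eq_zero_or_pos p.2 with h2 | h2
      · rw [h2]; rfl
      · rw [hconv i p.1 (by omega), lapCoeff₀_zero_fun]

/-- Term `n` is a signed sum, counted by the Catalan recursion, of expressions with `n + 1` factors
`F` and `2 n + 1` applications of `lap`; these contribute `M` and `h / 2` each. -/
theorem norm_stripTerm_le {δ h M : ℝ} (hh : 0 < h) (hM0 : 0 ≤ M)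
    (hM : ∀ u ∈ substrip μ δ, ‖F u‖ ≤ M) (n : ℕ) : ∀ w ∈ substrip μ δ,
    ‖stripTerm F h n w‖ ≤ catalan n * (M ^ (n + 1) * (h / 2) ^ (2 * n + 1)) := by
  induction n using Nat.strong_induction_on with
  | _ n ih =>
    intro w hw
    cases n with
    | zero =>
      rw [stripTerm]
      simpa using norm_lap_le hh hM hw
    | succ n =>
      rw [stripTerm, norm_neg, catalan_succ, Nat.cast_sum, Finset.sum_mul]
      refine (norm_sum_le _ _).trans (Finset.sum_le_sum fun i _ => ?_)
      have hi := i.2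
      have h1 : ∀ u ∈ substrip μ δ, ‖stripTerm F h i u * stripTerm F h (n - i) u‖ ≤
          (catalan i * (M ^ ((i : ℕ) + 1) * (h / 2) ^ (2 * (i : ℕ) + 1))) *
          (catalan (n - i) * (M ^ (n - i + 1) * (h / 2) ^ (2 * (n - i) + 1))) := fun u hu => by
        rw [norm_mul]
        exact mul_le_mul (ih i (by omega) u hu) (ih (n - i) (by omega) u hu) (norm_nonneg _)
          (by positivity)
      refine (norm_lap_le hh h1 hw).trans (le_of_eq ?_)
      have e1 : n + 1 + 1 = ((i : ℕ) + 1) + (n - i + 1) := by omega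
      have e2 : 2 * (n + 1) + 1 = (2 * (i : ℕ) + 1) + (2 * (n - i) + 1) + 1 := by omega
      rw [e1, e2, pow_add, pow_succ, pow_add]
      push_cast
      ring

theorem catalan_le_four_pow (n : ℕ) : catalan n ≤ 4 ^ n := by
  rw [catalan_eq_centralBinom_div]
  refine (Nat.div_le_self _ _).trans ?_
  rw [Nat.centralBinom]
  calc (2 * n).choose n ≤ 2 ^ (2 * n) := Nat.choose_le_two_pow _ _
    _ = 4 ^ n := by rw [pow_mul]; norm_num

/-- The growth `4 ^ n` of the Catalan numbers cancels against `(1/2) ^ (2 n)`. -/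
theorem norm_stripTerm_le_geometric {δ h M : ℝ} (hh : 0 < h) (hM0 : 0 ≤ M)
    (hM : ∀ u ∈ substrip μ δ, ‖F u‖ ≤ M) (n : ℕ) {w : ℂ} (hw : w ∈ substrip μ δ) :
    ‖stripTerm F h n w‖ ≤ M * h * (M * h ^ 2) ^ n := by
  refine (norm_stripTerm_le hh hM0 hM n w hw).trans ?_
  have h1 : (catalan n : ℝ) ≤ 4 ^ n := by exact_mod_cast catalan_le_four_pow n
  calc (catalan n : ℝ) * (M ^ (n + 1) * (h / 2) ^ (2 * n + 1))
      ≤ 4 ^ n * (M ^ (n + 1) * (h / 2) ^ (2 * n + 1)) := by gcongr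
    _ = M * (h / 2) * (M * h ^ 2) ^ n := by
      rw [pow_succ, pow_succ, pow_mul, mul_pow, div_pow, div_pow]
      have : (4 : ℝ) ^ n ≠ 0 := by positivity
      norm_num
      field_simp
    _ ≤ M * h * (M * h ^ 2) ^ n := by
      gcongr
      linarith

end Terms

/-! ### The sum of the series and the integral equation -/

/-- The sum of the series `∑ stripTerm F h n`. -/
def stripSum (F : ℂ → ℂ) (h : ℝ) (w : ℂ) : ℂ := ∑' n, stripTerm F h n w

section Sum

variable {μ : EReal} {F : ℂ → ℂ} {δ h M : ℝ}

/-- The threshold `1 / (2 (1 + M))` gives both `h ≤ 1` and a ratio of at most `1 / 2`. -/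
theorem mul_sq_le_half (hM0 : 0 ≤ M) (hh : h ∈ Ioo 0 (1 / (2 * (1 + M)))) : M * h ^ 2 ≤ 1 / 2 := by
  have h1 : h * (2 * (1 + M)) < 1 := (lt_div_iff₀ (by positivity)).1 hh.2
  have h2 : h ≤ 1 := by nlinarith [hh.1]
  nlinarith [hh.1, mul_nonneg hM0 hh.1.le]

theorem summable_geometric_bound (hM0 : 0 ≤ M) (hh : h ∈ Ioo 0 (1 / (2 * (1 + M)))) :
    Summable fun n : ℕ => M * h * (M * h ^ 2) ^ n :=
  (summable_geometric_of_lt_one (by positivity)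
    ((mul_sq_le_half hM0 hh).trans_lt (by norm_num))).mul_left _

theorem summable_norm_stripTerm (hM0 : 0 ≤ M) (hM : ∀ u ∈ substrip μ δ, ‖F u‖ ≤ M)
    (hh : h ∈ Ioo 0 (1 / (2 * (1 + M)))) {w : ℂ} (hw : w ∈ substrip μ δ) :
    Summable fun n => ‖stripTerm F h n w‖ :=
  Summable.of_nonneg_of_le (fun _ => norm_nonneg _)
    (fun n => norm_stripTerm_le_geometric hh.1 hM0 hM n hw) (summable_geometric_bound hM0 hh)

theorem BddHol.differentiableOn_stripSum (hF : BddHol μ F) (hδ : 0 < δ) (hM0 : 0 ≤ M)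
    (hM : ∀ u ∈ substrip μ δ, ‖F u‖ ≤ M) (hh : h ∈ Ioo 0 (1 / (2 * (1 + M)))) :
    DifferentiableOn ℂ (stripSum F h) (substrip μ δ) :=
  Complex.differentiableOn_tsum_of_summable_norm (summable_geometric_bound hM0 hh)
    (fun n => (hF.stripTerm hh.1 n).holo.mono (substrip_subset_strip hδ.le))
    (isOpen_substrip μ δ) fun n _ hw => norm_stripTerm_le_geometric hh.1 hM0 hM n hw

/-- The tail of a geometric series of ratio at most `1 / 2`, whence the factor `2`. The case `N = 0`
bounds the sum itself. -/
theorem norm_stripSum_sub_le (hM0 : 0 ≤ M) (hM : ∀ u ∈ substrip μ δ, ‖F u‖ ≤ M)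
    (hh : h ∈ Ioo 0 (1 / (2 * (1 + M)))) {w : ℂ} (hw : w ∈ substrip μ δ) (N : ℕ) :
    ‖stripSum F h w - ∑ n ∈ Finset.range N, stripTerm F h n w‖ ≤
      2 * M ^ (N + 1) * h ^ (2 * N + 1) := by
  have hs := summable_norm_stripTerm hM0 hM hh hw
  have hq := mul_sq_le_half hM0 hh
  have hpos := hh.1
  have hq1 : M * h ^ 2 < 1 := hq.trans_lt (by norm_num)
  rw [stripSum, ← hs.of_norm.sum_add_tsum_nat_add N, add_sub_cancel_left]
  have hgeo : HasSum (fun n : ℕ => M * h * (M * h ^ 2) ^ N * (M * h ^ 2) ^ n)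
      (M * h * (M * h ^ 2) ^ N * (1 - M * h ^ 2)⁻¹) :=
    (hasSum_geometric_of_lt_one (by positivity) hq1).mul_left _
  refine (tsum_of_norm_bounded hgeo fun n => ?_).trans ?_
  · refine (norm_stripTerm_le_geometric hh.1 hM0 hM (n + N) hw).trans (le_of_eq ?_)
    rw [pow_add]; ring
  · have h1 : (1 - M * h ^ 2)⁻¹ ≤ 2 := by
      rw [inv_le_comm₀ (by linarith) two_pos]
      linarith
    calc M * h * (M * h ^ 2) ^ N * (1 - M * h ^ 2)⁻¹ ≤ M * h * (M * h ^ 2) ^ N * 2 := by gcongr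
      _ = _ := by rw [mul_pow, ← pow_mul]; ring

theorem BddHol.integrableOn_stripSum_sq (hF : BddHol μ F) (hδ : 0 < δ) (hM0 : 0 ≤ M)
    (hM : ∀ u ∈ substrip μ δ, ‖F u‖ ≤ M) (hh : h ∈ Ioo 0 (1 / (2 * (1 + M)))) {w : ℂ}
    (hw : w ∈ substrip μ δ) :
    IntegrableOn (fun t : ℝ => (Real.exp (2 * t / h) : ℂ) * stripSum F h (w + t) ^ 2)
      (Iic 0) := by
  refine integrableOn_exp_mul (f := fun u => stripSum F h u ^ 2) (M := (2 * M ^ 1 * h ^ 1) ^ 2)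
    hh.1 ((hF.differentiableOn_stripSum hδ hM0 hM hh).continuousOn.pow 2) (fun u hu => ?_) hw
  rw [norm_pow]
  refine pow_le_pow_left₀ (norm_nonneg _) ?_ 2
  simpa using norm_stripSum_sub_le hM0 hM hh hu 0

/-- The integral equation in the coordinate of the strip. -/
theorem BddHol.stripSum_eq (hF : BddHol μ F) (hδ : 0 < δ) (hM0 : 0 ≤ M)
    (hM : ∀ u ∈ substrip μ δ, ‖F u‖ ≤ M) (hh : h ∈ Ioo 0 (1 / (2 * (1 + M)))) {w : ℂ}
    (hw : w ∈ substrip μ δ) :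
    stripSum F h w = -WKB.lap h (fun u => stripSum F h u ^ 2) w + WKB.lap h F w := by
  have hws := substrip_subset_strip hδ.le hw
  let B : ℕ → ℝ := fun n => M * h * (M * h ^ 2) ^ n
  have hpos := hh.1
  have hB0 : ∀ n, 0 ≤ B n := fun n => by positivity
  have hB : Summable fun n => ‖B n‖ := (summable_geometric_bound hM0 hh).norm
  have hBc := summable_norm_sum_mul_range_of_summable_norm hB hB
  -- `T n` is the Cauchy product coefficient of the squared series, and `lap` maps it to minus the
  -- term of index `n + 1`. The Cauchy square of the majorant `B` is summable, which justifies
  -- exchanging sum and integral.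
  let T : ℕ → ℂ → ℂ := fun n u =>
    ∑ i ∈ Finset.range (n + 1), WKB.stripTerm F h i u * WKB.stripTerm F h (n - i) u
  have hT : ∀ n, BddHol μ (T n) := fun n =>
    BddHol.sum _ fun i _ => (hF.stripTerm hh.1 i).mul (hF.stripTerm hh.1 (n - i))
  have hTb : ∀ n, ∀ u ∈ substrip μ δ, ‖T n u‖ ≤ ‖∑ i ∈ Finset.range (n + 1), B i * B (n - i)‖ := by
    intro n u hu
    refine ((norm_sum_le _ _).trans (Finset.sum_le_sum fun i _ => ?_)).trans (le_abs_self _)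
    rw [norm_mul]
    exact mul_le_mul (norm_stripTerm_le_geometric hh.1 hM0 hM i hu)
      (norm_stripTerm_le_geometric hh.1 hM0 hM (n - i) hu) (norm_nonneg _) (hB0 i)
  have hTlap : ∀ n, WKB.lap h (T n) w = -WKB.stripTerm F h (n + 1) w := by
    intro n
    rw [WKB.stripTerm, neg_neg, Finset.sum_range (fun i =>
      WKB.lap h (fun u => WKB.stripTerm F h i u * WKB.stripTerm F h (n - i) u) w) |>.symm]
    simp only [WKB.lap, T]
    rw [← integral_finsetSum _ fun i _ =>
      ((hF.stripTerm hh.1 i).mul (hF.stripTerm hh.1 (n - i))).integrableOn hh.1 hws]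
    simp only [Finset.mul_sum]
  have hsum : HasSum (fun n => WKB.lap h (T n) w)
      (∫ t in Iic (0 : ℝ), ∑' n, (Real.exp (2 * t / h) : ℂ) * T n (w + t)) := by
    refine hasSum_integral_of_summable_integral_norm
      (fun n => (hT n).integrableOn hh.1 hws) ?_
    refine Summable.of_nonneg_of_le (fun n => integral_nonneg fun t => norm_nonneg _) (fun n => ?_)
      (hBc.mul_right (h / 2))
    rw [← integral_exp_two_mul_div hh.1, ← integral_const_mul]
    exact integral_mono ((hT n).integrableOn hh.1 hws).norm
      ((integrableOn_exp_two_mul_div hh.1).const_mul _)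
      fun t => norm_exp_mul_le (hTb n) hw t
  have hsq : (∫ t in Iic (0 : ℝ), ∑' n, (Real.exp (2 * t / h) : ℂ) * T n (w + t)) =
      WKB.lap h (fun u => stripSum F h u ^ 2) w := by
    rw [WKB.lap]
    congr 1
    funext t
    have hs := summable_norm_stripTerm hM0 hM hh (add_mem_substrip hw t)
    rw [tsum_mul_left, sq, stripSum, tsum_mul_tsum_eq_tsum_sum_range_of_summable_norm hs hs]
  rw [hsq] at hsum
  simp only [hTlap] at hsum
  have h1 := hsum.tsum_eq
  rw [tsum_neg] at h1
  have h2 := (summable_norm_stripTerm hM0 hM hh hw).of_norm.sum_add_tsum_nat_add 1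
  rw [Finset.sum_range_one] at h2
  have h3 : WKB.stripTerm F h 0 w = WKB.lap h F w := by rw [WKB.stripTerm]
  rw [← h1, ← h3, stripSum, ← h2]
  ring

/-- Cutting the series after `N` terms costs `O(h ^ (2 N + 1))`, less than the error allowed. In the
finite sum, `h ^ k` occurs only in terms with `2 n + 1 ≤ k`, that is `n < (k + 1) / 2`. -/
theorem BddHol.asympOn_stripSum (hF : BddHol μ F) (hδ : 0 < δ) (hM0 : 0 ≤ M)
    (hM : ∀ u ∈ substrip μ δ, ‖F u‖ ≤ M) :
    AsympOn (substrip μ δ) (1 / (2 * (1 + M))) (stripSum F)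
      (fun k w => ∑ n ∈ Finset.range ((k + 1) / 2), WKB.stripCoeff F n k w) := by
  intro N
  obtain ⟨C, hC⟩ := AsympOn.sum (Finset.range N)
    (fun n _ => hF.asympOn_stripTerm (H := 1 / (2 * (1 + M))) hδ n) N
  refine ⟨2 * M ^ (N + 1) + C, fun h hh w hw => ?_⟩
  have hpos := hh.1
  have hh1 : h ≤ 1 := by
    have h1 : h * (2 * (1 + M)) < 1 := (lt_div_iff₀ (by positivity)).1 hh.2
    nlinarith [hh.1]
  have hcoef : ∀ k ∈ Finset.range N, (∑ n ∈ Finset.range ((k + 1) / 2), WKB.stripCoeff F n k w) =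
      ∑ n ∈ Finset.range N, WKB.stripCoeff F n k w := by
    intro k hk
    have hk' := Finset.mem_range.1 hk
    refine Finset.sum_subset (fun n hn => ?_) fun n _ hn => ?_
    · have := Finset.mem_range.1 hn
      exact Finset.mem_range.2 (by omega)
    · have h1 : ¬n < (k + 1) / 2 := fun h => hn (Finset.mem_range.2 h)
      rw [stripCoeff_eq_zero F n k (by omega)]
  change ‖_ - ∑ k ∈ Finset.range N,
    (∑ n ∈ Finset.range ((k + 1) / 2), WKB.stripCoeff F n k w) * (h : ℂ) ^ k‖ ≤ _
  rw [Finset.sum_congr rfl fun k hk => by rw [hcoef k hk]]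
  have h1 := norm_stripSum_sub_le hM0 hM hh hw N
  have h2 := hC h hh w hw
  have h3 : h ^ (2 * N + 1) ≤ h ^ N := pow_le_pow_of_le_one hpos.le hh1 (by omega)
  have h4 := norm_add_le _ _ |>.trans (add_le_add h1 h2)
  rw [sub_add_sub_cancel] at h4
  refine h4.trans ?_
  rw [add_mul]
  gcongr

end Sum

/-! ### Transfer from the strip to `Ω` -/

section Transfer

variable {Q : Polynomial ℂ} {Ω : Set ℂ} {r S ψ : ℂ → ℂ}

theorem IsGlobalInverse.integrand_eq (hψ : IsGlobalInverse Ω r S ψ) {f g : ℂ → ℂ}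
    (hfg : ∀ w ∈ strip (mu Ω S), f (ψ w) / Q.eval (ψ w) = g w) {x : ℂ} (hx : x ∈ Ω) (h : ℝ) :
    integrand Q Ω r h f x = fun t : ℝ => (Real.exp (2 * t / h) : ℂ) * g (S x + t) := by
  funext t
  rw [integrand, hψ.flow_eq hx, hfg _ (add_mem_strip (hψ.mapsTo x hx) t)]

theorem IsGlobalInverse.Kplus_eq (hψ : IsGlobalInverse Ω r S ψ) {f g : ℂ → ℂ}
    (hfg : ∀ w ∈ strip (mu Ω S), f (ψ w) / Q.eval (ψ w) = g w) {x : ℂ} (hx : x ∈ Ω) (h : ℝ) :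
    Kplus Q Ω r h f x = r x * lap h g (S x) := by
  rw [Kplus, hψ.integrand_eq hfg hx, lap]

/-- The two factors `√Q` cancel the weight `1 / Q` of `K₊`; this makes the recursion for the `g_n`
weight-free. -/
theorem IsGlobalInverse.mul_div_eq (hψ : IsGlobalInverse Ω r S ψ) (hr : IsSqrtBranch Q Ω r)
    {f₁ f₂ g₁ g₂ : ℂ → ℂ} (h₁ : ∀ x ∈ Ω, f₁ x = r x * g₁ (S x))
    (h₂ : ∀ x ∈ Ω, f₂ x = r x * g₂ (S x)) :
    ∀ w ∈ strip (mu Ω S), f₁ (ψ w) * f₂ (ψ w) / Q.eval (ψ w) = g₁ w * g₂ w := by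
  intro w hw
  have hm := hψ.mem w hw
  have hne := hψ.ne_zero _ hm
  rw [h₁ _ hm, h₂ _ hm, hψ.right_inv w hw, ← hr.sq _ hm]
  field_simp

theorem IsGlobalInverse.Wterm_eq (hψ : IsGlobalInverse Ω r S ψ) (hr : IsSqrtBranch Q Ω r)
    (h : ℝ) (n : ℕ) : ∀ x ∈ Ω,
    Wterm Q Ω r h (n + 1) x = r x * stripTerm (stripPot Q ψ) h n (S x) := by
  induction n using Nat.strong_induction_on with
  | _ n ih =>
    intro x hx
    cases n with
    | zero =>
      rw [stripTerm, zero_add, Wterm]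
      exact hψ.Kplus_eq (fun w _ => rfl) hx h
    | succ n =>
      rw [Wterm, stripTerm, mul_neg, Finset.mul_sum]
      refine congrArg Neg.neg (Finset.sum_congr rfl fun i _ => ?_)
      have e : n + 1 - (i : ℕ) = (n - i) + 1 := by omega
      rw [e]
      exact hψ.Kplus_eq (hψ.mul_div_eq hr (ih i i.2) (ih (n - i) (by omega))) hx h

theorem Wterm_zero (h : ℝ) (x : ℂ) : Wterm Q Ω r h 0 x = 0 := by
  rw [Wterm]

theorem gTerm_zero (x : ℂ) (h : ℝ) : gTerm Q Ω r 0 x h = 0 := by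
  rw [gTerm, Wterm_zero, zero_div]

theorem IsGlobalInverse.gTerm_eq (hψ : IsGlobalInverse Ω r S ψ) (hr : IsSqrtBranch Q Ω r)
    (n : ℕ) {x : ℂ} (hx : x ∈ Ω) (h : ℝ) :
    gTerm Q Ω r (n + 1) x h = stripTerm (stripPot Q ψ) h n (S x) := by
  rw [gTerm, hψ.Wterm_eq hr h n x hx, mul_div_cancel_left₀ _ (hψ.ne_zero x hx)]

theorem IsGlobalInverse.gSum_eq (hψ : IsGlobalInverse Ω r S ψ) (hr : IsSqrtBranch Q Ω r)
    {x : ℂ} (hx : x ∈ Ω) (h : ℝ) : gSum Q Ω r x h = stripSum (stripPot Q ψ) h (S x) := by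
  rw [gSum, stripSum, ← Nat.succ_injective.tsum_eq (f := fun n => gTerm Q Ω r n x h)]
  · exact tsum_congr fun n => hψ.gTerm_eq hr n hx h
  · intro n hn
    cases n with
    | zero => exact (hn (gTerm_zero x h)).elim
    | succ n => exact ⟨n, rfl⟩

/-- No summability is needed: over a field `tsum` commutes with multiplication by a constant even
for divergent series. -/
theorem IsGlobalInverse.Wsum_eq_mul_gSum (hψ : IsGlobalInverse Ω r S ψ) {x : ℂ} (hx : x ∈ Ω)
    (h : ℝ) : Wsum Q Ω r x h = r x * gSum Q Ω r x h := by
  rw [Wsum, gSum, ← tsum_mul_left]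
  refine tsum_congr fun n => ?_
  rw [gTerm, mul_div_cancel₀ _ (hψ.ne_zero x hx)]

theorem IsGlobalInverse.hasExpansion (hψ : IsGlobalInverse Ω r S ψ) {f : ℝ → ℂ → ℂ}
    {b : ℕ → ℂ → ℂ} {φ : ℂ → ℝ → ℂ} {a : ℕ → ℂ → ℂ}
    (hb : ∀ k, DifferentiableOn ℂ (b k) (strip (mu Ω S)))
    (hf : ∀ δ > 0, ∃ H > 0, (∀ h ∈ Ioo 0 H, DifferentiableOn ℂ (f h) (substrip (mu Ω S) δ)) ∧
      AsympOn (substrip (mu Ω S) δ) H f b)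
    (hφ : ∀ x ∈ Ω, ∀ h, φ x h = f h (S x)) (ha : ∀ k, ∀ x ∈ Ω, a k x = b k (S x)) :
    HasExpansion Ω S φ a := by
  have hSd : DifferentiableOn ℂ S Ω := fun x hx =>
    (hψ.deriv x hx).differentiableAt.differentiableWithinAt
  refine ⟨fun k => ((hb k).comp hSd hψ.mapsTo).congr (ha k), fun δ hδ => ?_⟩
  obtain ⟨H, hH, hd, hasy⟩ := hf δ hδ
  refine ⟨H, hH, fun h hh => ?_, fun N => ?_⟩
  · exact ((hd h hh).comp (hSd.mono fun x hx => hx.1) fun x hx => (mem_subdomain_iff.1 hx).2).congr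
      fun x hx => hφ x hx.1 h
  -- `HasExpansion` counts the last power kept, `AsympOn` the number of terms.
  · obtain ⟨C, hC⟩ := hasy (N + 1)
    refine ⟨C, fun h hh x hx => ?_⟩
    rw [hφ x hx.1 h, Finset.sum_congr rfl fun k _ => by rw [ha k x hx.1]]
    exact hC h hh (S x) (mem_subdomain_iff.1 hx).2

end Transfer

/-! ### The coefficients and the theorem -/

/-- The coefficients `a_{n,k}` of the expansions of `g_n`. -/
def gCoeff (Q : Polynomial ℂ) (S ψ : ℂ → ℂ) : ℕ → ℕ → ℂ → ℂ
  | 0 => fun _ _ => 0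
  | n + 1 => fun k x => stripCoeff (stripPot Q ψ) n k (S x)

theorem sum_Icc_one_eq_sum_range (f : ℕ → ℂ) (m : ℕ) :
    ∑ n ∈ Finset.Icc 1 m, f n = ∑ n ∈ Finset.range m, f (n + 1) := by
  induction m with
  | zero => simp
  | succ m ih => rw [Finset.sum_Icc_succ_top (by omega), ih, Finset.sum_range_succ]

end WKB

end

theorem mainTheorem4 (Q : Polynomial ℂ) (Ω : Set ℂ) (hΩ : WKB.IsStokesDomain Q Ω)
    (a : ℂ) (ha : Q.IsRoot a) (haΩ : a ∈ frontier Ω)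
    (r S : ℂ → ℂ) (hr : WKB.IsSqrtBranch Q Ω r) (hS : WKB.IsIntegralFrom Ω a r S)
    (hpos : ∀ x ∈ Ω, 0 < (S x).im) :
    -- the trajectories exist for all times, and the integrals that define the terms converge
    (∀ x ∈ Ω, WKB.IsTrajectory Ω r x (fun t => WKB.flow Ω r t x)) ∧
    (∀ h : ℝ, 0 < h → ∀ x ∈ Ω,
      IntegrableOn (WKB.integrand Q Ω r h (WKB.potC Q) x) (Iic 0) ∧
      ∀ i j : ℕ, IntegrableOn (WKB.integrand Q Ω r h
        (fun y => WKB.Wterm Q Ω r h i y * WKB.Wterm Q Ω r h j y) x) (Iic 0)) ∧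
    -- the series for `g` converges and `W = √Q g` solves the integral equation
    (∀ δ : ℝ, 0 < δ → ∃ H : ℝ, 0 < H ∧ ∀ h ∈ Ioo 0 H, ∀ x ∈ WKB.subdomain Ω S δ,
      Summable (fun n => WKB.gTerm Q Ω r n x h) ∧
      WKB.Wsum Q Ω r x h = r x * WKB.gSum Q Ω r x h ∧
      IntegrableOn (WKB.integrand Q Ω r h (fun y => WKB.Wsum Q Ω r y h ^ 2) x) (Iic 0) ∧
      WKB.Wsum Q Ω r x h =
        -WKB.Kplus Q Ω r h (fun y => WKB.Wsum Q Ω r y h ^ 2) x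
          + WKB.Kplus Q Ω r h (WKB.potC Q) x) ∧
    -- the expansions of the terms `g_n` and of `g`
    ∃ α : ℕ → ℕ → ℂ → ℂ,
      (∀ n k : ℕ, k + 1 < 2 * n → ∀ x ∈ Ω, α n k x = 0) ∧
      (∀ x ∈ Ω, α 1 1 x = WKB.potC Q x / (2 * Q.eval x)) ∧
      (∀ n : ℕ, 1 ≤ n → WKB.HasExpansion Ω S (WKB.gTerm Q Ω r n) (α n)) ∧
      WKB.HasExpansion Ω S (WKB.gSum Q Ω r)
        (fun k x => ∑ n ∈ Finset.Icc 1 ((k + 1) / 2), α n k x) := by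
  obtain ⟨ψ, hψ⟩ := WKB.exists_isGlobalInverse hΩ ha haΩ hr hS hpos
  have hQ : ∀ x ∈ Ω, Q.eval x ≠ 0 := fun x hx => hΩ.eval_ne_zero hx
  have hF : WKB.BddHol (WKB.mu Ω S) (WKB.stripPot Q ψ) := ⟨hψ.differentiableOn_stripPot hQ,
    fun δ hδ => hψ.exists_norm_stripPot_le hr hQ hΩ.ne_zero hδ⟩
  have hbound : ∀ δ > 0, ∃ M, 0 ≤ M ∧ ∀ w ∈ WKB.substrip (WKB.mu Ω S) δ, ‖WKB.stripPot Q ψ w‖ ≤ M := by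
    intro δ hδ
    obtain ⟨M, hM⟩ := hF.bdd δ hδ
    exact ⟨|M|, abs_nonneg M, fun w hw => (hM w hw).trans (le_abs_self M)⟩
  have hH : ∀ {M : ℝ}, 0 ≤ M → 0 < 1 / (2 * (1 + M)) := fun hM => by positivity
  refine ⟨fun x hx => hψ.isTrajectory_flow hx, fun h hh x hx => ⟨?_, fun i j => ?_⟩,
    fun δ hδ => ?_, WKB.gCoeff Q S ψ, fun n k hnk x hx => ?_, fun x hx => ?_, fun n hn => ?_, ?_⟩
  · rw [hψ.integrand_eq (g := WKB.stripPot Q ψ) (fun w _ => rfl) hx]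
    exact hF.integrableOn hh (hψ.mapsTo x hx)
  · have hterm : ∀ i, ∃ g : ℂ → ℂ, WKB.BddHol (WKB.mu Ω S) g ∧
        ∀ y ∈ Ω, WKB.Wterm Q Ω r h i y = r y * g (S y) := by
      intro i
      cases i with
      | zero => exact ⟨fun _ => 0, WKB.BddHol.zero, fun y _ => by rw [WKB.Wterm_zero, mul_zero]⟩
      | succ i => exact ⟨_, hF.stripTerm hh i, hψ.Wterm_eq hr h i⟩
    obtain ⟨g₁, hg₁, e₁⟩ := hterm i
    obtain ⟨g₂, hg₂, e₂⟩ := hterm j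
    rw [hψ.integrand_eq (hψ.mul_div_eq hr e₁ e₂) hx]
    exact (hg₁.mul hg₂).integrableOn hh (hψ.mapsTo x hx)
  · obtain ⟨M, hM0, hM⟩ := hbound δ hδ
    refine ⟨_, hH hM0, fun h hh x hx => ?_⟩
    obtain ⟨hxΩ, hxδ⟩ := WKB.mem_subdomain_iff.1 hx
    -- Needed on all of `Ω`, although convergence is known only on `Ω_δ`: the identity between the
    -- `tsum`s holds regardless of convergence.
    have hW : ∀ y ∈ Ω, WKB.Wsum Q Ω r y h = r y * WKB.stripSum (WKB.stripPot Q ψ) h (S y) := fun y hy => by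
      rw [hψ.Wsum_eq_mul_gSum hy, hψ.gSum_eq hr hy]
    have hsq : ∀ w ∈ WKB.strip (WKB.mu Ω S), WKB.Wsum Q Ω r (ψ w) h ^ 2 / Q.eval (ψ w) =
        WKB.stripSum (WKB.stripPot Q ψ) h w ^ 2 := fun w hw => by
      rw [sq, sq]
      exact hψ.mul_div_eq hr hW hW w hw
    refine ⟨?_, hψ.Wsum_eq_mul_gSum hxΩ h, ?_, ?_⟩
    · rw [← summable_nat_add_iff 1]
      simp only [hψ.gTerm_eq hr _ hxΩ]
      exact (WKB.summable_norm_stripTerm hM0 hM hh hxδ).of_norm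
    · rw [hψ.integrand_eq (f := fun y => WKB.Wsum Q Ω r y h ^ 2) hsq hxΩ]
      exact hF.integrableOn_stripSum_sq hδ hM0 hM hh hxδ
    · rw [hW x hxΩ, hψ.Kplus_eq (f := fun y => WKB.Wsum Q Ω r y h ^ 2) hsq hxΩ,
        hψ.Kplus_eq (f := WKB.potC Q) (g := WKB.stripPot Q ψ) (fun w _ => rfl) hxΩ,
        hF.stripSum_eq hδ hM0 hM hh hxδ]
      ring
  · cases n with
    | zero => rfl
    | succ n =>
      exact congrFun (WKB.stripCoeff_eq_zero (WKB.stripPot Q ψ) n k (by omega)) (S x)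
  · change WKB.stripCoeff (WKB.stripPot Q ψ) 0 1 (S x) = _
    rw [WKB.stripCoeff]
    change WKB.stripPot Q ψ (S x) / 2 = _
    rw [WKB.stripPot, hψ.left_inv x hx, div_div, mul_comm 2]
  · obtain ⟨n, rfl⟩ : ∃ m, n = m + 1 := ⟨n - 1, by omega⟩
    -- A single term has its expansion on every range of `h`, so `H = 1` is arbitrary.
    refine hψ.hasExpansion (f := fun h => WKB.stripTerm (WKB.stripPot Q ψ) h n)
      (fun k => (hF.stripCoeff n k).holo) (fun δ hδ => ⟨1, one_pos, fun h hh => ?_, ?_⟩)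
      (fun x hx h => hψ.gTerm_eq hr n hx h) fun k x _ => rfl
    · exact (hF.stripTerm hh.1 n).holo.mono (WKB.substrip_subset_strip hδ.le)
    · exact hF.asympOn_stripTerm hδ n
  · refine hψ.hasExpansion (f := WKB.stripSum (WKB.stripPot Q ψ))
      (b := fun k w => ∑ n ∈ Finset.range ((k + 1) / 2), WKB.stripCoeff (WKB.stripPot Q ψ) n k w)
      (fun k => (WKB.BddHol.sum _ fun n _ => hF.stripCoeff n k).holo) (fun δ hδ => ?_)
      (fun x hx h => hψ.gSum_eq hr hx h) fun k x _ => WKB.sum_Icc_one_eq_sum_range _ _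
    obtain ⟨M, hM0, hM⟩ := hbound δ hδ
    exact ⟨_, hH hM0, fun h hh => hF.differentiableOn_stripSum hδ hM0 hM hh,
      hF.asympOn_stripSum hδ hM0 hM⟩
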